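/- Let $L,\delta>0$. Let $\zeta(z)=\zeta(z|L/2,{\rm i}\delta)$ and $\wp=-\zeta'$ be the Weierstrass functions with half-periods $\omega_1=L/2$, $\omega_2={\rm i}\delta$ (period lattice $\Lambda=L\mathbb Z+2{\rm i}\delta\mathbb Z$), and put $\zeta_j(z)=\zeta(z)-\frac{\zeta(\omega_j)}{\omega_j}z$ for $j=1,2$. For $L$-periodic $f$ let $$(Tf)(x)=\frac1\pi\,\mathrm{p.v.}\!\!\int_{-L/2}^{L/2}\zeta_1(x'-x)f(x')\,dx',\qquad (\tilde Tf)(x)=\frac1\pi\int_{-L/2}^{L/2}\zeta_1(x'-x+{\rm i}\delta)f(x')\,dx'.$$ Let $N\ge 0$ be an integer and let $a_j,b_j\in\mathbb C$ $(j=1,\dots,N)$ satisfy $$|\mathrm{Im}\,a_j-2\delta n|>\delta/2,\qquad |\mathrm{Im}\,b_j-2\delta n|>\delta/2\qquad\text{for all } n\in\mathbb Z .$$ Let $I\subseteq\mathbb R$ be an open interval containing $0$ (possibly $I=\mathbb R$), and let $z_j,w_j:I\to\mathbb C$ be twice differentiable functions such that for all $t\in I$ and all $j$: $z_j-z_k\notin\Lambda$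 and $w_j-w_k\notin\Lambda$ for $k\ne j$; $\mathrm{Im}(z_j\pm{\rm i}\delta/2)\ne 2\delta n$ and $\mathrm{Im}(w_j\pm{\rm i}\delta/2)\neq 2\delta n$ for all integers $n$; and the elliptic Calogero--Moser equations $$\ddot z_j=-4\sum_{k\ne j}\wp'(z_j-z_k),\qquad \ddot w_j=-4\sum_{k\neq j}\wp'(w_j-w_k)$$ hold, with initial conditions $z_j(0)=a_j$, $w_j(0)=b_j$, $$\dot z_j(0)=2{\rm i}\sum_{k\ne j}\zeta_2(a_j-a_k)-2{\rm i}\sum_{k=1}^N\zeta_2(a_j-b_k+{\rm i}\delta),\qquad \dot w_j(0)=-2{\rm i}\sum_{k\ne j}\zeta_2(b_j-b_k)+2{\rm i}\sum_{k=1}^N\zeta_2(b_j-a_k+{\rm i}\delta).$$ Then the functions $$u(x,t)={\rm i}\sum_{j=1}^N\zeta_2\big(x-z_j(t)-\tfrac{{\rm i}\delta}2\big)-{\rm i}\sum_{j=1}^N\zeta_2\big(x-w_j(t)+\tfrac{{\rm i}\delta}2\big),$$ $$v(x,t)=-{\rm i}\sum_{j=1}^N\zeta_2\big(x-z_j(t)+\tfrac{{\rm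 i}\delta}2\big)+{\rm i}\sum_{j=1}^N\zeta_2\big(x-w_j(t)-\tfrac{{\rm i}\delta}2\big)$$ are $L$-periodic in $x$ and are a classical solution (jointly $C^2$, with all integrals in $Tu_{xx},Tv_{xx},\tilde Tu_{xx},\tilde Tv_{xx}$ existing) of the periodic non-chiral intermediate long-wave equation $$u_t+2uu_x+Tu_{xx}+\tilde Tv_{xx}=0,\qquad v_t-2vv_x-Tv_{xx}-\tilde Tu_{xx}=0\qquad (x\in\mathbb R,\ t\in I).$$ -/

import Mathlib

open MeasureTheory Filter Topology

noncomputable section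

namespace NcILW

/-- The periods `L` and `2iδ`, that is, the half-periods `ω₁ = L/2` and `ω₂ = iδ`. -/
def periods (L δ : ℝ) (hL : 0 < L) (hδ : 0 < δ) : PeriodPair where
  ω₁ := (L : ℂ)
  ω₂ := 2 * Complex.I * (δ : ℂ)
  indep := by
    rw [LinearIndependent.pair_iff]
    intro s t h
    have h1 := congrArg Complex.re h
    have h2 := congrArg Complex.im h
    simp at h1 h2
    exact ⟨h1.resolve_right hL.ne', h2.resolve_right hδ.ne'⟩

/-- The Weierstrass `ζ`-function of the lattice `Λ` of `P`,
`ζ(z) = 1/z + ∑_{l ∈ Λ, l ≠ 0} (1/(z - l) + 1/l + z/l²)`;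
with `1/0 = 0` the term `l = 0` of the sum below is `1/z`. -/
def weierstrassZeta (P : PeriodPair) (z : ℂ) : ℂ :=
  ∑' l : P.lattice, (1 / (z - (l : ℂ)) + 1 / (l : ℂ) + z / (l : ℂ) ^ 2)

/-- `ζ₁(z) = ζ(z) - (η₁/ω₁) z`, where `ω₁` is the first half-period and `η₁ = ζ(ω₁)`.
(The fields of `P` are the full periods.) -/
def zeta₁ (P : PeriodPair) (z : ℂ) : ℂ :=
  weierstrassZeta P z - weierstrassZeta P (P.ω₁ / 2) / (P.ω₁ / 2) * z

/-- `ζ₂(z) = ζ(z) - (η₂/ω₂) z`, where `ω₂` is the second half-period and `η₂ = ζ(ω₂)`. -/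
def zeta₂ (P : PeriodPair) (z : ℂ) : ℂ :=
  weierstrassZeta P z - weierstrassZeta P (P.ω₂ / 2) / (P.ω₂ / 2) * z

/-- The part of the period interval `[-L/2, L/2]` at distance more than `ε` from the
singularities `x + Lℤ` of the kernel `x' ↦ ζ₁(x' - x)`. -/
def truncatedInterval (L x ε : ℝ) : Set ℝ :=
  {x' | x' ∈ Set.Icc (-(L / 2)) (L / 2) ∧ ∀ n : ℤ, ε < |x' - x - n * L|}

/-- `(T f)(x)` exists and equals `y`, where
`(T f)(x) = (1/π) p.v. ∫_{-L/2}^{L/2} ζ₁(x' - x | L/2, iδ) f(x') dx'`. -/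
def HasT (L δ : ℝ) (hL : 0 < L) (hδ : 0 < δ) (f : ℝ → ℂ) (x : ℝ) (y : ℂ) : Prop :=
  (∀ ε : ℝ, 0 < ε →
    IntegrableOn (fun x' : ℝ => zeta₁ (periods L δ hL hδ) ((x' : ℂ) - (x : ℂ)) * f x')
      (truncatedInterval L x ε)) ∧
  Tendsto
    (fun ε : ℝ => 1 / (Real.pi : ℂ) *
      ∫ x' in truncatedInterval L x ε,
        zeta₁ (periods L δ hL hδ) ((x' : ℂ) - (x : ℂ)) * f x')
    (𝓝[>] 0) (𝓝 y)

/-- `(T̃ f)(x)` exists and equals `y`, where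
`(T̃ f)(x) = (1/π) ∫_{-L/2}^{L/2} ζ₁(x' - x + iδ | L/2, iδ) f(x') dx'`. -/
def HasTtilde (L δ : ℝ) (hL : 0 < L) (hδ : 0 < δ) (f : ℝ → ℂ) (x : ℝ) (y : ℂ) : Prop :=
  IntervalIntegrable
    (fun x' : ℝ =>
      zeta₁ (periods L δ hL hδ) ((x' : ℂ) - (x : ℂ) + Complex.I * (δ : ℂ)) * f x')
    volume (-(L / 2)) (L / 2) ∧
  1 / (Real.pi : ℂ) * (∫ x' in (-(L / 2))..(L / 2),
    zeta₁ (periods L δ hL hδ) ((x' : ℂ) - (x : ℂ) + Complex.I * (δ : ℂ)) * f x') = y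

/-- `(u, v)` is a (classical, complex-valued, `L`-periodic) solution of the periodic non-chiral
intermediate long-wave equation
`u_t + 2 u u_x + T u_xx + T̃ v_xx = 0`, `v_t - 2 v v_x - T v_xx - T̃ u_xx = 0`
for `x ∈ ℝ` and `t` in the open set `I`. -/
structure IsPeriodicSolution (L δ : ℝ) (hL : 0 < L) (hδ : 0 < δ) (I : Set ℝ)
    (u v : ℝ → ℝ → ℂ) : Prop where
  contDiffOn_u : ContDiffOn ℝ 2 (fun p : ℝ × ℝ => u p.1 p.2) (Set.univ ×ˢ I)
  contDiffOn_v : ContDiffOn ℝ 2 (fun p : ℝ × ℝ => v p.1 p.2) (Set.univ ×ˢ I)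
  periodic_u : ∀ t ∈ I, ∀ x : ℝ, u (x + L) t = u x t
  periodic_v : ∀ t ∈ I, ∀ x : ℝ, v (x + L) t = v x t
  equation : ∀ t ∈ I, ∀ x : ℝ, ∃ Tu Tv Ttu Ttv : ℂ,
    HasT L δ hL hδ (iteratedDeriv 2 (fun y : ℝ => u y t)) x Tu ∧
    HasT L δ hL hδ (iteratedDeriv 2 (fun y : ℝ => v y t)) x Tv ∧
    HasTtilde L δ hL hδ (iteratedDeriv 2 (fun y : ℝ => u y t)) x Ttu ∧
    HasTtilde L δ hL hδ (iteratedDeriv 2 (fun y : ℝ => v y t)) x Ttv ∧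
    deriv (fun s : ℝ => u x s) t + 2 * u x t * deriv (fun y : ℝ => u y t) x + Tu + Ttv = 0 ∧
    deriv (fun s : ℝ => v x s) t - 2 * v x t * deriv (fun y : ℝ => v y t) x - Tv - Ttu = 0

/-- The elliptic Calogero–Moser equations
`z̈_j = -4 ∑_{k ≠ j} ℘'(z_j - z_k | L/2, iδ)` for `t` in the open set `I`, for `N` particles
which do not collide on the torus `ℂ / (Lℤ + 2iδℤ)` and whose positions satisfy
`Im (z_j ± iδ/2) ≠ 2δn` for all integers `n`. -/
structure IsCalogeroMoser (L δ : ℝ) (hL : 0 < L) (hδ : 0 < δ) (I : Set ℝ) {N : ℕ}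
    (z : Fin N → ℝ → ℂ) : Prop where
  differentiableAt : ∀ t ∈ I, ∀ j, DifferentiableAt ℝ (z j) t
  noncollision : ∀ t ∈ I, ∀ j k, j ≠ k → z j t - z k t ∉ (periods L δ hL hδ).lattice
  equation : ∀ t ∈ I, ∀ j,
    HasDerivAt (deriv (z j))
      (-4 * ∑ k ∈ Finset.univ.erase j, (periods L δ hL hδ).derivWeierstrassP (z j t - z k t)) t
  im_ne : ∀ t ∈ I, ∀ j, ∀ n : ℤ,
    (z j t + Complex.I * (δ : ℂ) / 2).im ≠ 2 * δ * n ∧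
    (z j t - Complex.I * (δ : ℂ) / 2).im ≠ 2 * δ * n

/-- `u = i ∑_j ζ₂(x - z_j(t) - iδ/2 | L/2, iδ) - i ∑_j ζ₂(x - w_j(t) + iδ/2 | L/2, iδ)`. -/
def solitonU (L δ : ℝ) (hL : 0 < L) (hδ : 0 < δ) {N : ℕ} (z w : Fin N → ℝ → ℂ)
    (x t : ℝ) : ℂ :=
  Complex.I * ∑ j, zeta₂ (periods L δ hL hδ) ((x : ℂ) - z j t - Complex.I * (δ : ℂ) / 2)
  - Complex.I * ∑ j, zeta₂ (periods L δ hL hδ) ((x : ℂ) - w j t + Complex.I * (δ : ℂ) / 2)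

/-- `v = -i ∑_j ζ₂(x - z_j(t) + iδ/2 | L/2, iδ) + i ∑_j ζ₂(x - w_j(t) - iδ/2 | L/2, iδ)`. -/
def solitonV (L δ : ℝ) (hL : 0 < L) (hδ : 0 < δ) {N : ℕ} (z w : Fin N → ℝ → ℂ)
    (x t : ℝ) : ℂ :=
  -Complex.I * ∑ j, zeta₂ (periods L δ hL hδ) ((x : ℂ) - z j t + Complex.I * (δ : ℂ) / 2)
  + Complex.I * ∑ j, zeta₂ (periods L δ hL hδ) ((x : ℂ) - w j t - Complex.I * (δ : ℂ) / 2)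

end NcILW

end

open scoped PeriodPair

noncomputable section

namespace NcILW

/-! Give charge r = 1 to the points z_j + iδ/2 and charge r = -1 to the points w_j - iδ/2, and call
these 2N points p_m. Since ζ₂ has period 2iδ, u = U_0 and v = -U_{iδ}, where U_σ(x) = i ∑ r_m ζ₂(x +
σ - p_m). The total charge is zero; this removes the constants that ζ₂ acquires under x ↦ x + L, and
it is what makes the many-pole sums collapse.

The local part rests on the addition formula for ζ (`additionDefect_eq_zero`). If the poles obey
p_j' = 2i ∑_{m ≠ j} r_m ζ₂(p_j - p_m), it gives U_t + 2 U U_x = -∑ ℘'(x + σ - p_m)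
(`pole_ansatz_identity`). Differentiating this law in time gives p_j'' = -2 ∑ (1 + r_j r_m) ℘'(p_j -
p_m): like charges interact as Calogero–Moser particles and opposite charges not at all, so z and w
decouple. Conversely, given the second-order equations, the defect between p_j' and the prescribed
velocity solves a homogeneous linear ODE and vanishes at t = 0, hence on all of I
(`deriv_eq_poleVelocity`).

For the nonlocal part, the differentiated addition formula writes ζ₁(x' - x) ℘'(x' - p) as a
multiple of ζ₁(x' - x) plus a function of x' - p that can be integrated explicitly. The integrals of
ζ₁ along horizontal lines within 2δ of the real axis, and off it, are ∓πi according to the side.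
Consequently T[℘'(· - p)] - T̃[℘'(· + iδ - p)] = ±i ℘'(x - p), with a sign depending only on the
strip containing p (`exists_hasT_hasTtilde`). The poles never leave their strips, and there the sign
is the charge, so T u_xx + T̃ v_xx = ∑ ℘'(x - p_m), which cancels the local part. The second
equation is the same computation at σ = iδ. -/

section

/-! ### The Weierstrass ζ-function: convergence, derivative, quasi-periods. -/

variable (P : PeriodPair)

/-- The Weierstrass `ζ`-function without its pole at the origin. -/
def zetaReg (z : ℂ) : ℂ :=
  ∑' l : P.lattice, if (l : ℂ) = 0 then 0 else (1 / (z - (l : ℂ)) + 1 / (l : ℂ) + z / (l : ℂ) ^ 2)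

/-- The three terms combine to s² / (l² (s - l)), which decays cubically in l; this is summable over
a lattice of rank 2. -/
lemma zetaReg_bound (r : ℝ) (s : ℂ) (hs : ‖s‖ < r) (l : ℂ) (h : 2 * r ≤ ‖l‖) :
    ‖1 / (s - l) + 1 / l + s / l ^ 2‖ ≤ 2 * r ^ 2 * ‖l‖ ^ (-3 : ℝ) := by
  have hr : 0 < r := (norm_nonneg s).trans_lt hs
  have hl : 0 < ‖l‖ := by linarith
  have hl0 : l ≠ 0 := norm_pos_iff.mp hl
  have hsl : ‖l‖ / 2 ≤ ‖s - l‖ := by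
    rw [norm_sub_rev]
    exact .trans (by linarith) (norm_sub_norm_le l s)
  have hsl0 : s - l ≠ 0 := norm_pos_iff.mp (by linarith)
  have e : 1 / (s - l) + 1 / l + s / l ^ 2 = s ^ 2 / (l ^ 2 * (s - l)) := by
    field_simp
    ring
  have e2 : ‖l‖ ^ (-3 : ℝ) = 1 / ‖l‖ ^ 3 := by
    rw [Real.rpow_neg hl.le, one_div]
    norm_cast
  rw [e, e2, norm_div, norm_mul, norm_pow, norm_pow, mul_one_div,
    div_le_div_iff₀ (by positivity) (by positivity)]
  have h1 : ‖s‖ ^ 2 ≤ r ^ 2 := by gcongr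
  calc ‖s‖ ^ 2 * ‖l‖ ^ 3 ≤ r ^ 2 * ‖l‖ ^ 3 := by gcongr
    _ = 2 * r ^ 2 * (‖l‖ ^ 2 * (‖l‖ / 2)) := by ring
    _ ≤ _ := by gcongr

lemma hasSumLocallyUniformly_zetaReg :
    HasSumLocallyUniformly
      (fun (l : P.lattice) (z : ℂ) =>
        if (l : ℂ) = 0 then 0 else (1 / (z - (l : ℂ)) + 1 / (l : ℂ) + z / (l : ℂ) ^ 2))
      (zetaReg P) := by
  refine P.hasSumLocallyUniformly_aux (u := fun r l => 2 * r ^ 2 * ‖l‖ ^ (-3 : ℝ)) _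
    (fun _ _ ↦ (ZLattice.summable_norm_rpow _ _ (by simp; norm_num)).mul_left _) fun r hr ↦
    Filter.eventually_atTop.mpr ⟨2 * r, ?_⟩
  rintro _ h s hs l rfl
  split_ifs
  · rw [norm_zero]
    positivity
  · exact zetaReg_bound r s hs l h

lemma hasDerivAt_zetaReg_summand {l z : ℂ} (h : z ≠ l) :
    HasDerivAt (fun z : ℂ => 1 / (z - l) + 1 / l + z / l ^ 2)
      (-(1 / (z - l) ^ 2 - 1 / l ^ 2)) z := by
  have h1 := ((hasDerivAt_id z).sub_const l).inv (sub_ne_zero.mpr h)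
  have h2 := (hasDerivAt_id z).div_const (l ^ 2)
  convert! ((h1.add_const (1 / l)).add h2) using 1
  · ext y; simp
  · simp; ring

lemma differentiableOn_zetaReg_partialSum (s : Finset P.lattice) :
    DifferentiableOn ℂ (fun z : ℂ => ∑ l ∈ s,
      if (l : ℂ) = 0 then 0 else (1 / (z - (l : ℂ)) + 1 / (l : ℂ) + z / (l : ℂ) ^ 2))
      ((P.lattice : Set ℂ) \ {0})ᶜ := by
  refine .fun_sum fun l _ => ?_
  split_ifs with hl
  · simp
  · intro z hz
    have : z ≠ l := by rintro rfl; exact hz ⟨l.2, hl⟩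
    exact (hasDerivAt_zetaReg_summand this).differentiableAt.differentiableWithinAt

lemma hasDerivAt_zetaReg {z : ℂ} (hz : z ∈ ((P.lattice : Set ℂ) \ {0})ᶜ) :
    HasDerivAt (zetaReg P) (-P.weierstrassPExcept 0 z) z := by
  have hU : IsOpen ((P.lattice : Set ℂ) \ {0})ᶜ := P.isOpen_compl_lattice_sdiff
  have hlu := (hasSumLocallyUniformly_zetaReg P).hasSumLocallyUniformlyOn
    (s := ((P.lattice : Set ℂ) \ {0})ᶜ)
  have hd : DifferentiableOn ℂ (zetaReg P) ((P.lattice : Set ℂ) \ {0})ᶜ :=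
    hlu.differentiableOn (.of_forall fun s => differentiableOn_zetaReg_partialSum P s) hU
  have hder : deriv (zetaReg P) z = -P.weierstrassPExcept 0 z := by
    have t1 := (((hasSumLocallyUniformly_zetaReg P).tendstoLocallyUniformlyOn.deriv
      (.of_forall fun s => differentiableOn_zetaReg_partialSum P s) hU).tendsto_at hz)
    refine tendsto_nhds_unique t1 ?_
    have t2 : Tendsto _ atTop _ := (P.hasSum_weierstrassPExcept 0 z).neg
    refine t2.congr fun s => ?_
    simp only [Function.comp_apply]
    symm
    refine HasDerivAt.deriv (HasDerivAt.fun_sum fun l _ => ?_)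
    split_ifs with hl
    · simpa using hasDerivAt_const z (0 : ℂ)
    · have : z ≠ l := by rintro rfl; exact hz ⟨l.2, hl⟩
      exact hasDerivAt_zetaReg_summand this
  rw [← hder]
  exact (hd.differentiableAt (hU.mem_nhds hz)).hasDerivAt

lemma zeta_eq_zetaReg_add (z : ℂ) : weierstrassZeta P z = zetaReg P z + 1 / z := by
  have h1 : Summable fun l : P.lattice =>
      (if (l : ℂ) = 0 then 0 else (1 / (z - (l : ℂ)) + 1 / (l : ℂ) + z / (l : ℂ) ^ 2)) :=
    ⟨_, (hasSumLocallyUniformly_zetaReg P).hasSum⟩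
  have h2 : HasSum (fun l : P.lattice => if l = 0 then 1 / z else 0) (1 / z) :=
    hasSum_ite_eq 0 (1 / z)
  rw [zetaReg, ← h2.tsum_eq, ← h1.tsum_add h2.summable, weierstrassZeta]
  congr with l
  by_cases hl : l = 0
  · simp [hl]
  · have : (l : ℂ) ≠ 0 := by simpa using hl
    simp [hl]

lemma zetaReg_neg (z : ℂ) : zetaReg P (-z) = -zetaReg P z := by
  simp only [zetaReg]
  rw [← (Equiv.neg P.lattice).tsum_eq, ← tsum_neg]
  congr with l
  by_cases hl : (l : ℂ) = 0
  · simp [hl]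
  · have e : -z - -(l : ℂ) = -(z - l) := by ring
    simp only [Equiv.neg_apply, NegMemClass.coe_neg, neg_eq_zero, hl, if_false, e, one_div,
      inv_neg, even_two, Even.neg_pow, neg_div]
    ring

@[simp] lemma zetaReg_zero : zetaReg P 0 = 0 := by
  simpa [CharZero.eq_neg_self_iff] using zetaReg_neg P 0

lemma zeta_neg (z : ℂ) : weierstrassZeta P (-z) = -weierstrassZeta P z := by
  rw [zeta_eq_zetaReg_add, zeta_eq_zetaReg_add, zetaReg_neg]
  simp [div_neg]
  ring

variable {P}

lemma hasDerivAt_zeta {z : ℂ} (hz : z ∉ P.lattice) :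
    HasDerivAt (weierstrassZeta P) (-℘[P] z) z := by
  have hz0 : z ≠ 0 := by rintro rfl; exact hz P.lattice.zero_mem
  have h1 := hasDerivAt_zetaReg P (z := z) (fun h => hz h.1)
  have h2 := (hasDerivAt_id z).inv hz0
  have e : weierstrassZeta P = fun z => zetaReg P z + (id z)⁻¹ := by
    ext y; rw [zeta_eq_zetaReg_add]; simp
  rw [e]
  convert! h1.add h2 using 1
  have := P.weierstrassPExcept_add 0 z
  simp only [ZeroMemClass.coe_zero, sub_zero] at this
  rw [← this]
  simp
  ring

lemma hasDerivAt_weierstrassP {z : ℂ} (hz : z ∉ P.lattice) :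
    HasDerivAt ℘[P] (℘'[P] z) z := by
  have := (P.analyticOnNhd_weierstrassP z hz).differentiableAt.hasDerivAt
  rwa [P.deriv_weierstrassP] at this

lemma hasDerivAt_derivWeierstrassP {z : ℂ} (hz : z ∉ P.lattice) :
    HasDerivAt ℘'[P] (deriv ℘'[P] z) z :=
  (P.analyticOnNhd_derivWeierstrassP z hz).differentiableAt.hasDerivAt

lemma isConnected_compl_lattice : IsConnected ((P.lattice : Set ℂ)ᶜ) := by
  refine Set.Countable.isConnected_compl_of_one_lt_rank (by simp) ?_
  exact countable_of_Lindelof_of_discrete (X := P.lattice)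

lemma add_notMem {z l : ℂ} (hl : l ∈ P.lattice) (hz : z ∉ P.lattice) : z + l ∉ P.lattice :=
  fun h => hz ((P.lattice.add_mem_iff_left hl).mp h)

lemma neg_notMem {z : ℂ} (hz : z ∉ P.lattice) : -z ∉ P.lattice :=
  fun h => hz (by simpa using P.lattice.neg_mem h)

/-- Both sides have derivative -℘ on the connected complement of the lattice, so they differ by a
constant. At z = -l/2 oddness of ζ shows that the constant is zero; l/2 must avoid the lattice for
this evaluation to be available. -/
lemma zeta_add_period {l : ℂ} (hl : l ∈ P.lattice) (hl2 : l / 2 ∉ P.lattice) {z : ℂ}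
    (hz : z ∉ P.lattice) :
    weierstrassZeta P (z + l) = weierstrassZeta P z + 2 * weierstrassZeta P (l / 2) := by
  have key : Set.EqOn (fun z => weierstrassZeta P (z + l))
      (fun z => weierstrassZeta P z + 2 * weierstrassZeta P (l / 2)) (P.lattice : Set ℂ)ᶜ := by
    have hd1 : ∀ x ∈ (P.lattice : Set ℂ)ᶜ,
        HasDerivAt (fun z => weierstrassZeta P (z + l)) (-℘[P] x) x := by
      intro x hx
      have := (hasDerivAt_zeta (add_notMem hl hx)).comp_add_const x l
      rwa [P.weierstrassP_add_coe x ⟨l, hl⟩] at this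
    have hd2 : ∀ x ∈ (P.lattice : Set ℂ)ᶜ,
        HasDerivAt (fun z => weierstrassZeta P z + 2 * weierstrassZeta P (l / 2)) (-℘[P] x) x :=
      fun x hx => (hasDerivAt_zeta hx).add_const _
    refine P.isClosed_lattice.isOpen_compl.eqOn_of_deriv_eq (𝕜 := ℂ) (x := -(l / 2))
      isConnected_compl_lattice.isPreconnected
      (fun x hx => (hd1 x hx).differentiableAt.differentiableWithinAt)
      (fun x hx => (hd2 x hx).differentiableAt.differentiableWithinAt)
      (fun x hx => (hd1 x hx).deriv.trans (hd2 x hx).deriv.symm) (neg_notMem hl2) ?_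
    have e : -(l / 2) + l = l / 2 := by ring
    simp only [e, zeta_neg]
    ring
  exact key hz

end

/-! ### Liouville's theorem on the torus and the addition formula for ζ. -/

section

variable {P : PeriodPair}

lemma exists_zeta_add_period {l : ℂ} (hl : l ∈ P.lattice) :
    ∃ η : ℂ, ∀ z ∉ P.lattice, weierstrassZeta P (z + l) = weierstrassZeta P z + η := by
  have hd1 : ∀ x ∈ (P.lattice : Set ℂ)ᶜ,
      HasDerivAt (fun z => weierstrassZeta P (z + l)) (-℘[P] x) x := by
    intro x hx
    have := (hasDerivAt_zeta (add_notMem hl hx)).comp_add_const x l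
    rwa [P.weierstrassP_add_coe x ⟨l, hl⟩] at this
  obtain ⟨η, hη⟩ := P.isClosed_lattice.isOpen_compl.exists_eq_add_of_deriv_eq (𝕜 := ℂ)
    isConnected_compl_lattice.isPreconnected
    (fun x hx => (hd1 x hx).differentiableAt.differentiableWithinAt)
    (fun x hx => (hasDerivAt_zeta hx).differentiableAt.differentiableWithinAt)
    (fun x hx => (hd1 x hx).deriv.trans (hasDerivAt_zeta hx).deriv.symm)
  exact ⟨η, fun z hz => hη hz⟩

lemma eventually_notMem_lattice (x : ℂ) : ∀ᶠ y in 𝓝[≠] x, y ∉ P.lattice := by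
  have h1 : ∀ᶠ y in 𝓝[≠] x, y ∈ ((P.lattice : Set ℂ) \ {x})ᶜ :=
    nhdsWithin_le_nhds (P.compl_lattice_sdiff_singleton_mem_nhds x)
  filter_upwards [h1, self_mem_nhdsWithin] with y h hy hyl
  exact h ⟨hyl, hy⟩

lemma tendsto_add_const_nhdsNE (x l : ℂ) : Tendsto (fun y => y + l) (𝓝[≠] x) (𝓝[≠] (x + l)) := by
  refine tendsto_nhdsWithin_of_tendsto_nhds_of_eventually_within _ ?_ ?_
  · exact ((continuous_id.add continuous_const).tendsto x).mono_left nhdsWithin_le_nhds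
  · filter_upwards [self_mem_nhdsWithin] with y hy h
    exact hy (by simpa using h)

lemma eventually_sub_notMem_lattice (b x : ℂ) : ∀ᶠ y in 𝓝[≠] x, y - b ∉ P.lattice := by
  have := (tendsto_add_const_nhdsNE x (-b)).eventually (eventually_notMem_lattice (P := P) (x + -b))
  simpa [sub_eq_add_neg] using this

/-- A function on the torus with removable singularities only is constant. -/
lemma eqOn_const_of_periodic_of_removable {f : ℂ → ℂ}
    (hper : ∀ l ∈ P.lattice, ∀ x, ∀ᶠ y in 𝓝[≠] x, f (y + l) = f y)
    (hdiff : ∀ x, ∀ᶠ y in 𝓝[≠] x, DifferentiableAt ℂ f y)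
    (hrem : ∀ x, ∃ l ∈ P.lattice, ∃ g : ℂ → ℂ, ContinuousAt g (x + l) ∧ f =ᶠ[𝓝[≠] (x + l)] g) :
    ∃ c, ∀ x, ContinuousAt f x → f x = c := by
  -- The punctured limits define the extension F; by periodicity it suffices to find the limit at
  -- one lattice translate. Working with punctured neighbourhoods makes the values assigned to f at
  -- its singularities irrelevant.
  have hlim : ∀ x, ∃ y, Tendsto f (𝓝[≠] x) (𝓝 y) := by
    intro x
    obtain ⟨l, hl, g, hg, hfg⟩ := hrem x
    refine ⟨g (x + l), ?_⟩
    have h1 : Tendsto f (𝓝[≠] (x + l)) (𝓝 (g (x + l))) :=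
      (hg.tendsto.mono_left nhdsWithin_le_nhds).congr' hfg.symm
    exact (h1.comp (tendsto_add_const_nhdsNE x l)).congr' (hper l hl x)
  choose F hF using hlim
  have hFf : ∀ x, ContinuousAt f x → F x = f x := fun x hx =>
    tendsto_nhds_unique (hF x) (hx.tendsto.mono_left nhdsWithin_le_nhds)
  have hFdiff : Differentiable ℂ F := by
    intro x
    have hev : ∀ᶠ y in 𝓝[≠] x, F y = f y := (hdiff x).mono fun y hy => hFf y hy.continuousAt
    refine (Complex.analyticAt_of_differentiable_on_punctured_nhds_of_continuousAt ?_
      ?_).differentiableAt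
    · filter_upwards [eventually_eventually_nhdsWithin.mpr hev, hdiff x, self_mem_nhdsWithin]
        with y hy hfy hyx
      rw [isOpen_compl_singleton.nhdsWithin_eq hyx] at hy
      exact hfy.congr_of_eventuallyEq hy
    · rw [← continuousWithinAt_compl_self]
      exact (hF x).congr' (hev.mono fun y hy => hy.symm)
  have hFper : ∀ z w : ℂ, w ∈ P.lattice → F (z + w) = F z := by
    intro z w hw
    exact tendsto_nhds_unique
      (((hF (z + w)).comp (tendsto_add_const_nhdsNE z w)).congr' (hper w hw z)) (hF z)
  have hb := IsZLattice.isCompact_range_of_periodic P.lattice F hFdiff.continuous hFper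
  exact ⟨F 0, fun x hx => (hFf x hx).symm.trans (hFdiff.apply_eq_apply_of_bounded hb.isBounded x 0)⟩


lemma hasDerivAt_zeta_comp_sub {z b : ℂ} (hz : z - b ∉ P.lattice) :
    HasDerivAt (fun z => weierstrassZeta P (z - b)) (-℘[P] (z - b)) z :=
  (hasDerivAt_zeta hz).comp_sub_const z b

lemma analyticAt_zetaReg_zero : AnalyticAt ℂ (zetaReg P) 0 := by
  have hU : IsOpen ((P.lattice : Set ℂ) \ {0})ᶜ := P.isOpen_compl_lattice_sdiff
  have : DifferentiableOn ℂ (zetaReg P) ((P.lattice : Set ℂ) \ {0})ᶜ := fun z hz =>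
    (hasDerivAt_zetaReg P hz).differentiableAt.differentiableWithinAt
  exact this.analyticAt (hU.mem_nhds (by simp))

lemma analyticAt_dslope_same {f : ℂ → ℂ} {a : ℂ} (h : AnalyticAt ℂ f a) :
    AnalyticAt ℂ (dslope f a) a := by
  obtain ⟨p, hp⟩ := h
  exact ⟨_, hp.has_fpower_series_dslope_fslope⟩

variable (P) in
/-- The defect in the addition formula for `ζ`. -/
def additionDefect (b a : ℂ) : ℂ :=
  (weierstrassZeta P b + weierstrassZeta P (a - b) - weierstrassZeta P a) * (℘[P] a - ℘[P] b)
    - (℘'[P] a + ℘'[P] b) / 2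

lemma additionDefect_differentiableAt {a b : ℂ} (ha : a ∉ P.lattice) (hab : a - b ∉ P.lattice) :
    DifferentiableAt ℂ (additionDefect P b) a :=
  ((((hasDerivAt_zeta_comp_sub hab).differentiableAt.const_add _).sub
    (hasDerivAt_zeta ha).differentiableAt).mul
    ((hasDerivAt_weierstrassP ha).differentiableAt.sub_const _)).sub
    (((hasDerivAt_derivWeierstrassP ha).differentiableAt.add_const _).div_const _)

lemma additionDefect_add_period {a b l : ℂ} (hl : l ∈ P.lattice) (ha : a ∉ P.lattice)
    (hab : a - b ∉ P.lattice) : additionDefect P b (a + l) = additionDefect P b a := by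
  obtain ⟨η, hη⟩ := exists_zeta_add_period hl
  have h1 := P.weierstrassP_add_coe a ⟨l, hl⟩
  have h2 := P.derivWeierstrassP_add_coe a ⟨l, hl⟩
  simp only at h1 h2
  have e : a + l - b = a - b + l := by ring
  simp only [additionDefect, h1, h2, e, hη _ ha, hη _ hab]
  ring

/-- The function m below vanishes to second order at 0, since ζ(a - b) = -ζ(b) - ℘(b) a + O(a²) and
the regular part of ζ has no constant or linear term. So m(a)/a² is regular. The ℘(b)/a terms
cancel, and the remaining 1/a³ cancels against the pole of ℘'(a)/2. -/
lemma additionDefect_removable_zero {b : ℂ} (hb : b ∉ P.lattice) :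
    ∃ g : ℂ → ℂ, ContinuousAt g 0 ∧ additionDefect P b =ᶠ[𝓝[≠] 0] g := by
  have hb' : (0 : ℂ) - b ∉ P.lattice := by simpa using hb
  have hp : AnalyticAt ℂ (P.weierstrassPExcept 0) 0 := P.analyticAt_weierstrassPExcept 0
  have hp1 : AnalyticAt ℂ (P.derivWeierstrassPExcept 0) 0 := P.analyticAt_derivWeierstrassPExcept 0
  have hk : AnalyticAt ℂ (fun a => weierstrassZeta P (a - b)) 0 := by
    have : AnalyticAt ℂ (weierstrassZeta P) (0 - b) := by
      have hd : DifferentiableOn ℂ (weierstrassZeta P) (P.lattice : Set ℂ)ᶜ := fun z hz =>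
        (hasDerivAt_zeta hz).differentiableAt.differentiableWithinAt
      exact hd.analyticAt (P.isClosed_lattice.isOpen_compl.mem_nhds hb')
    exact this.comp_of_eq (f := fun a => a - b) (by fun_prop) rfl
  set m : ℂ → ℂ := fun a => weierstrassZeta P b + weierstrassZeta P (a - b) - zetaReg P a
    + ℘[P] b * a with hm
  have hr : AnalyticAt ℂ (zetaReg P) 0 := analyticAt_zetaReg_zero
  have hma : AnalyticAt ℂ m 0 := by fun_prop
  have hm0 : m 0 = 0 := by simp [hm, zeta_neg]
  have hm1 : deriv m 0 = 0 := by
    have h1 := (((hasDerivAt_zeta_comp_sub hb').const_add (weierstrassZeta P b)).sub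
      (hasDerivAt_zetaReg P (z := 0) (by simp))).add ((hasDerivAt_id (0 : ℂ)).const_mul (℘[P] b))
    have h2 : HasDerivAt m _ 0 := h1
    rw [h2.deriv]
    simp
  refine ⟨fun a => (weierstrassZeta P b + weierstrassZeta P (a - b) - zetaReg P a)
      * (P.weierstrassPExcept 0 a - ℘[P] b) + dslope (dslope m 0) 0 a
      - dslope (P.weierstrassPExcept 0) 0 a
      - (P.derivWeierstrassPExcept 0 a + ℘'[P] b) / 2, ?_, ?_⟩
  · have h1 := (analyticAt_dslope_same (analyticAt_dslope_same hma)).continuousAt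
    have h2 := (analyticAt_dslope_same hp).continuousAt
    have h3 := hp.continuousAt
    have h4 := hp1.continuousAt
    have h5 := hr.continuousAt
    have h6 := hk.continuousAt
    fun_prop
  · filter_upwards [self_mem_nhdsWithin] with a ha
    have ha0 : a ≠ 0 := ha
    have e1 := P.weierstrassPExcept_add 0 a
    have e2 := P.derivWeierstrassPExcept_sub 0 a
    simp only [ZeroMemClass.coe_zero, sub_zero] at e1 e2
    have e3 : dslope (P.weierstrassPExcept 0) 0 a = P.weierstrassPExcept 0 a / a := by
      rw [dslope_of_ne _ ha0, slope_def_field]; simp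
    have e4 : dslope (dslope m 0) 0 a = m a / a ^ 2 := by
      rw [dslope_of_ne _ ha0, slope_def_field, dslope_of_ne _ ha0, slope_def_field, dslope_same,
        hm0, hm1]
      field_simp
      ring
    rw [additionDefect, e3, e4, ← e1, ← e2, zeta_eq_zetaReg_add P a, hm]
    field_simp
    ring

/-- The simple pole of ζ(a - b) meets the zero of ℘(a) - ℘(b); their product tends to ℘'(b), which
is exactly what is subtracted. -/
lemma additionDefect_tendsto_zero {b : ℂ} (hb : b ∉ P.lattice) :
    ∃ g : ℂ → ℂ, ContinuousAt g b ∧ g b = 0 ∧ additionDefect P b =ᶠ[𝓝[≠] b] g := by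
  refine ⟨fun a => (weierstrassZeta P b + zetaReg P (a - b) - weierstrassZeta P a)
    * (℘[P] a - ℘[P] b) + dslope ℘[P] b a - (℘'[P] a + ℘'[P] b) / 2, ?_, ?_, ?_⟩
  · have h1 : ContinuousAt (fun a => zetaReg P (a - b)) b := by
      refine ContinuousAt.comp_of_eq (g := zetaReg P) (f := fun a => a - b)
        analyticAt_zetaReg_zero.continuousAt (by fun_prop) (by simp)
    have h2 := (hasDerivAt_zeta hb).continuousAt
    have h3 := (hasDerivAt_weierstrassP hb).continuousAt
    have h4 := (hasDerivAt_derivWeierstrassP hb).continuousAt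
    have h5 : ContinuousAt (dslope ℘[P] b) b :=
      continuousAt_dslope_same.mpr (hasDerivAt_weierstrassP hb).differentiableAt
    fun_prop
  · simp [dslope_same]
  · filter_upwards [self_mem_nhdsWithin] with a ha
    have ha0 : a - b ≠ 0 := sub_ne_zero.mpr ha
    rw [additionDefect, dslope_of_ne _ ha, slope_def_field, zeta_eq_zetaReg_add P (a - b)]
    field_simp
    ring

/-- As a function of a, the defect is elliptic with removable singularities at 0 and b only, modulo
the lattice. Hence it is constant, and its limit at b identifies the constant as 0. -/
lemma additionDefect_eq_zero {a b : ℂ} (ha : a ∉ P.lattice) (hb : b ∉ P.lattice)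
    (hab : a - b ∉ P.lattice) : additionDefect P b a = 0 := by
  obtain ⟨c, hc⟩ := eqOn_const_of_periodic_of_removable (P := P) (f := additionDefect P b)
    (fun l hl x => by
      filter_upwards [eventually_notMem_lattice (P := P) x,
        eventually_sub_notMem_lattice (P := P) b x] with y h1 h2
      exact additionDefect_add_period hl h1 h2)
    (fun x => by
      filter_upwards [eventually_notMem_lattice (P := P) x,
        eventually_sub_notMem_lattice (P := P) b x] with y h1 h2
      exact additionDefect_differentiableAt h1 h2)
    (fun x => by
      by_cases hx : x ∈ P.lattice
      · obtain ⟨g, hg, hg'⟩ := additionDefect_removable_zero hb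
        exact ⟨-x, P.lattice.neg_mem hx, g, by simpa using hg, by simpa using hg'⟩
      by_cases hx' : x - b ∈ P.lattice
      · obtain ⟨g, hg, -, hg'⟩ := additionDefect_tendsto_zero hb
        exact ⟨-(x - b), P.lattice.neg_mem hx', g, by simpa using hg, by simpa using hg'⟩
      · refine ⟨0, P.lattice.zero_mem, additionDefect P b, ?_, EventuallyEq.rfl⟩
        simpa using (additionDefect_differentiableAt hx hx').continuousAt)
  have hc0 : c = 0 := by
    obtain ⟨g, hg, hg0, hg'⟩ := additionDefect_tendsto_zero hb
    have h1 : Tendsto (additionDefect P b) (𝓝[≠] b) (𝓝 0) := by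
      rw [← hg0]
      exact (hg.tendsto.mono_left nhdsWithin_le_nhds).congr' hg'.symm
    have h2 : Tendsto (additionDefect P b) (𝓝[≠] b) (𝓝 c) := by
      refine tendsto_const_nhds.congr' ?_
      filter_upwards [eventually_notMem_lattice (P := P) b,
        eventually_sub_notMem_lattice (P := P) b b] with y h1 h2
      exact (hc y (additionDefect_differentiableAt h1 h2).continuousAt).symm
    exact tendsto_nhds_unique h2 h1
  rw [hc a (additionDefect_differentiableAt ha hab).continuousAt, hc0]

/-- The addition formula for the Weierstrass `ζ`-function. -/
lemma zeta_addition {t d : ℂ} (ht : t ∉ P.lattice) (hd : d ∉ P.lattice) (hs : t + d ∉ P.lattice) :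
    2 * (weierstrassZeta P (t + d) - weierstrassZeta P t - weierstrassZeta P d)
      * (℘[P] t - ℘[P] d) = ℘'[P] t - ℘'[P] d := by
  have h := additionDefect_eq_zero ht (neg_notMem hd) (by simpa using hs)
  simp only [additionDefect, zeta_neg, sub_neg_eq_add, P.weierstrassP_neg,
    P.derivWeierstrassP_neg] at h
  linear_combination 2 * h

/-- The addition formula, differentiated along `t + d = const`. -/
lemma zeta_addition_deriv {t d : ℂ} (ht : t ∉ P.lattice) (hd : d ∉ P.lattice)
    (hs : t + d ∉ P.lattice) :
    2 * (℘[P] t - ℘[P] d) ^ 2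
      + 2 * (weierstrassZeta P (t + d) - weierstrassZeta P t - weierstrassZeta P d)
        * (℘'[P] t + ℘'[P] d) = deriv ℘'[P] t + deriv ℘'[P] d := by
  have hopen := P.isClosed_lattice.isOpen_compl
  have hpath : ∀ x e : ℂ, HasDerivAt (fun h : ℂ => x + e * h) e 0 := fun x e => by
    have := ((hasDerivAt_id (0 : ℂ)).const_mul e).const_add x
    rwa [mul_one] at this
  have ht1 : HasDerivAt (fun h : ℂ => t + 1 * h) 1 0 := hpath t 1
  have hd1 : HasDerivAt (fun h : ℂ => d + -1 * h) (-1) 0 := hpath d (-1)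
  have zt := (hasDerivAt_zeta ht).comp_of_eq (0 : ℂ) ht1 (by simp)
  have zd := (hasDerivAt_zeta hd).comp_of_eq (0 : ℂ) hd1 (by simp)
  have pt := (hasDerivAt_weierstrassP ht).comp_of_eq (0 : ℂ) ht1 (by simp)
  have pd := (hasDerivAt_weierstrassP hd).comp_of_eq (0 : ℂ) hd1 (by simp)
  have qt := (hasDerivAt_derivWeierstrassP ht).comp_of_eq (0 : ℂ) ht1 (by simp)
  have qd := (hasDerivAt_derivWeierstrassP hd).comp_of_eq (0 : ℂ) hd1 (by simp)
  have hL := (((zt.const_sub (weierstrassZeta P (t + d))).sub zd).const_mul 2).mul (pt.sub pd)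
  have hR := qt.sub qd
  have hev : ∀ᶠ h : ℂ in 𝓝 0, t + 1 * h ∉ P.lattice ∧ d + -1 * h ∉ P.lattice := by
    refine (ht1.continuousAt.eventually_mem (hopen.mem_nhds ?_)).and
      (hd1.continuousAt.eventually_mem (hopen.mem_nhds ?_)) <;> simpa
  have hLR := hL.unique (hR.congr_of_eventuallyEq ?_)
  · simp only [Function.comp_apply, Pi.sub_apply, mul_zero, add_zero] at hLR
    linear_combination hLR
  · filter_upwards [hev] with h hh
    have := zeta_addition hh.1 hh.2 (by ring_nf; simpa using hs)
    have e : t + 1 * h + (d + -1 * h) = t + d := by ring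
    rw [e] at this
    simpa using this

end

/-! ### Algebra of neutral systems of charged poles. -/

section

variable {P : PeriodPair}

variable (P) in
/-- The `ζ`-function with a linear term subtracted. -/
def zetaLin (c z : ℂ) : ℂ := weierstrassZeta P z - c * z

variable (P) in
/-- The derivative of `zetaLin`. -/
def zetaLinDeriv (c z : ℂ) : ℂ := -℘[P] z - c

lemma zetaLin_neg (c z : ℂ) : zetaLin P c (-z) = -zetaLin P c z := by
  simp only [zetaLin, zeta_neg]; ring

lemma hasDerivAt_zetaLin (c : ℂ) {z : ℂ} (hz : z ∉ P.lattice) :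
    HasDerivAt (zetaLin P c) (zetaLinDeriv P c z) z := by
  have h := (hasDerivAt_zeta hz).sub ((hasDerivAt_id z).const_mul c)
  rwa [mul_one] at h

lemma hasDerivAt_zetaLinDeriv (c : ℂ) {z : ℂ} (hz : z ∉ P.lattice) :
    HasDerivAt (zetaLinDeriv P c) (-℘'[P] z) z :=
  (hasDerivAt_weierstrassP hz).neg.sub_const c

/-- The linear terms drop out because b + (a - b) = a, so the difference of the two sides is the
addition defect up to sign. The right-hand side separates into a function of a plus the same
function of b. -/
lemma zetaLin_three_term (c : ℂ) {a b : ℂ} (ha : a ∉ P.lattice) (hb : b ∉ P.lattice)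
    (hab : a - b ∉ P.lattice) :
    zetaLinDeriv P c a * (zetaLin P c b + zetaLin P c (a - b))
        + zetaLinDeriv P c b * (zetaLin P c a + zetaLin P c (b - a))
      = (zetaLin P c a * zetaLinDeriv P c a - ℘'[P] a / 2)
        + (zetaLin P c b * zetaLinDeriv P c b - ℘'[P] b / 2) := by
  have h := additionDefect_eq_zero ha hb hab
  rw [show b - a = -(a - b) by ring, zetaLin_neg]
  simp only [additionDefect, zetaLin, zetaLinDeriv] at h ⊢
  linear_combination -h

/-- The weight r m * r l is symmetric, so only the symmetric part of G contributes, and this part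
separates. It turns interactions of pairs into one-pole terms multiplied by a sum of charges, which
neutrality then evaluates. -/
lemma sum_sum_erase_of_symm {ι : Type*} [DecidableEq ι] (s : Finset ι) (r F : ι → ℂ)
    (G : ι → ι → ℂ) (h : ∀ m ∈ s, ∀ l ∈ s, m ≠ l → G m l + G l m = F m + F l) :
    ∑ m ∈ s, ∑ l ∈ s.erase m, r m * r l * G m l
      = ∑ m ∈ s, r m * F m * ∑ l ∈ s.erase m, r l := by
  have e : ∀ (f : ι → ι → ℂ), ∑ m ∈ s, ∑ l ∈ s.erase m, f m l
      = ∑ m ∈ s, ∑ l ∈ s, if m = l then 0 else f m l := by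
    intro f
    refine Finset.sum_congr rfl fun m hm => ?_
    rw [← Finset.sum_erase s (a := m) (by simp)]
    refine Finset.sum_congr rfl fun l hl => ?_
    rw [if_neg (Finset.ne_of_mem_erase hl).symm]
  have swap : ∀ (f : ι → ι → ℂ), ∑ m ∈ s, ∑ l ∈ s.erase m, f m l
      = ∑ m ∈ s, ∑ l ∈ s.erase m, f l m := by
    intro f
    rw [e, e, Finset.sum_comm]
    simp only [eq_comm]
  have h1 : ∑ m ∈ s, ∑ l ∈ s.erase m, r m * r l * G m l
      + ∑ m ∈ s, ∑ l ∈ s.erase m, r m * r l * G m l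
      = ∑ m ∈ s, ∑ l ∈ s.erase m, r m * r l * F m
        + ∑ m ∈ s, ∑ l ∈ s.erase m, r m * r l * F m := by
    nth_rewrite 2 [swap]
    nth_rewrite 4 [swap]
    simp only [← Finset.sum_add_distrib]
    refine Finset.sum_congr rfl fun m hm => Finset.sum_congr rfl fun l hl => ?_
    have := h m hm l (Finset.mem_of_mem_erase hl) (Finset.ne_of_mem_erase hl).symm
    linear_combination r m * r l * this
  have h2 : ∑ m ∈ s, ∑ l ∈ s.erase m, r m * r l * F m
      = ∑ m ∈ s, r m * F m * ∑ l ∈ s.erase m, r l := by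
    refine Finset.sum_congr rfl fun m _ => ?_
    rw [Finset.mul_sum]
    exact Finset.sum_congr rfl fun l _ => by ring
  rw [← h2]
  linear_combination h1 / 2

lemma sum_zetaLin_three_term {ι : Type*} [DecidableEq ι] (c : ℂ) (s : Finset ι) (r p : ι → ℂ)
    (x : ℂ) (hx : ∀ m ∈ s, x - p m ∉ P.lattice)
    (hp : ∀ m ∈ s, ∀ l ∈ s, m ≠ l → p m - p l ∉ P.lattice) :
    ∑ m ∈ s, ∑ l ∈ s.erase m, r m * r l *
        (zetaLinDeriv P c (x - p m) * (zetaLin P c (x - p l) + zetaLin P c (p l - p m)))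
      = ∑ m ∈ s, r m * (zetaLin P c (x - p m) * zetaLinDeriv P c (x - p m)
          - ℘'[P] (x - p m) / 2) * ∑ l ∈ s.erase m, r l := by
  refine sum_sum_erase_of_symm s r
    (fun m => zetaLin P c (x - p m) * zetaLinDeriv P c (x - p m) - ℘'[P] (x - p m) / 2)
    (fun m l => zetaLinDeriv P c (x - p m) * (zetaLin P c (x - p l) + zetaLin P c (p l - p m)))
    fun m hm l hl hml => ?_
  have e : x - p m - (x - p l) = p l - p m := by ring
  have e' : x - p l - (x - p m) = p m - p l := by ring
  have := zetaLin_three_term c (hx m hm) (hx l hl) (by rw [e]; exact hp l hl m hm hml.symm)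
  rwa [e, e'] at this

variable {ι : Type*} [Fintype ι] [DecidableEq ι]

variable (P) in
/-- The velocities of the poles prescribed by the Bäcklund transformation. -/
def poleVelocity (c : ℂ) (r q : ι → ℂ) (j : ι) : ℂ :=
  2 * Complex.I * ∑ m ∈ Finset.univ.erase j, r m * zetaLin P c (q j - q m)

/-- The mutual interaction of j and m is split off; oddness adds its two contributions to r m + r j.
Every third pole l enters in the combination required by the three-term identity. -/
lemma poleVelocity_sub (c : ℂ) (r q : ι → ℂ) {j m : ι} (hjm : m ≠ j) :
    poleVelocity P c r q j - poleVelocity P c r q m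
      = 2 * Complex.I * ((r m + r j) * zetaLin P c (q j - q m)
        + ∑ l ∈ (Finset.univ.erase j).erase m,
          r l * (zetaLin P c (q j - q l) + zetaLin P c (q l - q m))) := by
  have h1 : ∑ l ∈ Finset.univ.erase j, r l * zetaLin P c (q j - q l)
      = r m * zetaLin P c (q j - q m)
        + ∑ l ∈ (Finset.univ.erase j).erase m, r l * zetaLin P c (q j - q l) :=
    (Finset.add_sum_erase _ _ (by simp [hjm])).symm
  have h2 : ∑ l ∈ Finset.univ.erase m, r l * zetaLin P c (q m - q l)
      = r j * zetaLin P c (q m - q j)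
        + ∑ l ∈ (Finset.univ.erase j).erase m, r l * zetaLin P c (q m - q l) := by
    rw [Finset.erase_right_comm]
    exact (Finset.add_sum_erase _ _ (by simp [hjm.symm])).symm
  have h3 : ∀ a b, zetaLin P c (q a - q b) = -zetaLin P c (q b - q a) := fun a b => by
    rw [← zetaLin_neg, neg_sub]
  have h4 : ∑ l ∈ (Finset.univ.erase j).erase m, r l * zetaLin P c (q m - q l)
      = -∑ l ∈ (Finset.univ.erase j).erase m, r l * zetaLin P c (q l - q m) := by
    rw [← Finset.sum_neg_distrib]
    exact Finset.sum_congr rfl fun l _ => by rw [h3 m l]; ring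
  simp only [poleVelocity, h1, h2, h4, h3 m j, mul_add, Finset.sum_add_distrib]
  ring

/-- The first-order pole dynamics implies the second-order Calogero–Moser equations. -/
lemma sum_zetaLinDeriv_mul_poleVelocity_sub (c : ℂ) (r q : ι → ℂ) (hr : ∑ m, r m = 0)
    (hr2 : ∀ m, r m ^ 2 = 1) (hq : ∀ m l, m ≠ l → q m - q l ∉ P.lattice) (j : ι) :
    2 * Complex.I * ∑ m ∈ Finset.univ.erase j, r m * (zetaLinDeriv P c (q j - q m)
        * (poleVelocity P c r q j - poleVelocity P c r q m))
      = -2 * ∑ m ∈ Finset.univ.erase j, (1 + r j * r m) * ℘'[P] (q j - q m) := by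
  have key := sum_zetaLin_three_term c (Finset.univ.erase j) r q (q j)
    (fun m hm => hq j m (Finset.ne_of_mem_erase hm).symm) (fun m _ l _ h => hq m l h)
  have e : ∀ m ∈ Finset.univ.erase j, r m * (zetaLinDeriv P c (q j - q m)
        * (poleVelocity P c r q j - poleVelocity P c r q m))
      = 2 * Complex.I * (r m * (r m + r j) *
          (zetaLin P c (q j - q m) * zetaLinDeriv P c (q j - q m)))
        + 2 * Complex.I * ∑ l ∈ (Finset.univ.erase j).erase m, r m * r l *
        (zetaLinDeriv P c (q j - q m) * (zetaLin P c (q j - q l) + zetaLin P c (q l - q m))) := by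
    intro m hm
    rw [poleVelocity_sub c r q (Finset.ne_of_mem_erase hm)]
    have : ∑ l ∈ (Finset.univ.erase j).erase m, r m * r l *
        (zetaLinDeriv P c (q j - q m) * (zetaLin P c (q j - q l) + zetaLin P c (q l - q m)))
        = r m * zetaLinDeriv P c (q j - q m) * ∑ l ∈ (Finset.univ.erase j).erase m,
          r l * (zetaLin P c (q j - q l) + zetaLin P c (q l - q m)) := by
      rw [Finset.mul_sum]
      exact Finset.sum_congr rfl fun l _ => by ring
    rw [this]
    ring
  rw [Finset.sum_congr rfl e, Finset.sum_add_distrib, ← Finset.mul_sum, ← Finset.mul_sum, key,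
    ← mul_add, ← Finset.sum_add_distrib, Finset.mul_sum, Finset.mul_sum, Finset.mul_sum]
  refine Finset.sum_congr rfl fun m hm => ?_
  -- By neutrality the third poles carry total charge -(r j + r m). Their ζζ' terms thus cancel the
  -- direct interaction r m * (r m + r j), and only the ℘' terms survive.
  have hs : ∑ l ∈ (Finset.univ.erase j).erase m, r l = -r j - r m := by
    have h1 := Finset.add_sum_erase Finset.univ r (Finset.mem_univ j)
    have h2 := Finset.add_sum_erase (Finset.univ.erase j) r hm
    linear_combination h2 + h1 + hr
  rw [hs]
  linear_combination (-2 * (r m ^ 2 + r m * r j) * ℘'[P] (q j - q m)) * (-1) * (-1)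
    * (Complex.I_sq) * (-1) - 2 * ℘'[P] (q j - q m) * hr2 m

/-- The nonlinear part of the equation, evaluated on the pole ansatz. -/
lemma pole_ansatz_identity (c : ℂ) (r p : ι → ℂ) (hr : ∑ m, r m = 0)
    (hr2 : ∀ m, r m ^ 2 = 1) (hp : ∀ m l, m ≠ l → p m - p l ∉ P.lattice) (x : ℂ)
    (hx : ∀ m, x - p m ∉ P.lattice) :
    Complex.I * ∑ m, r m * (zetaLinDeriv P c (x - p m) * -poleVelocity P c r p m)
      + 2 * (Complex.I * ∑ m, r m * zetaLin P c (x - p m))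
          * (Complex.I * ∑ m, r m * zetaLinDeriv P c (x - p m))
      = -∑ m, ℘'[P] (x - p m) := by
  have key := sum_zetaLin_three_term c Finset.univ r p x (fun m _ => hx m)
    (fun m _ l _ h => hp m l h)
  have h3 : ∀ a b, zetaLin P c (p a - p b) = -zetaLin P c (p b - p a) := fun a b => by
    rw [← zetaLin_neg, neg_sub]
  have e : ∀ m, Complex.I * (r m * (zetaLinDeriv P c (x - p m) * -poleVelocity P c r p m))
      + 2 * (Complex.I * ∑ l, r l * zetaLin P c (x - p l))
          * (Complex.I * (r m * zetaLinDeriv P c (x - p m)))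
      = -2 * (r m ^ 2 * (zetaLin P c (x - p m) * zetaLinDeriv P c (x - p m))
        + ∑ l ∈ Finset.univ.erase m, r m * r l *
        (zetaLinDeriv P c (x - p m) * (zetaLin P c (x - p l) + zetaLin P c (p l - p m)))) := by
    intro m
    have h1 := Finset.add_sum_erase Finset.univ (fun l => r l * zetaLin P c (x - p l))
      (Finset.mem_univ m)
    have h2 : ∑ l ∈ Finset.univ.erase m, r m * r l *
        (zetaLinDeriv P c (x - p m) * (zetaLin P c (x - p l) + zetaLin P c (p l - p m)))
        = r m * zetaLinDeriv P c (x - p m) * (∑ l ∈ Finset.univ.erase m,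
            r l * zetaLin P c (x - p l)
          - ∑ l ∈ Finset.univ.erase m, r l * zetaLin P c (p m - p l)) := by
      rw [← Finset.sum_sub_distrib, Finset.mul_sum]
      exact Finset.sum_congr rfl fun l _ => by rw [h3 m l]; ring
    rw [h2, ← h1, poleVelocity]
    linear_combination (2 * r m * zetaLinDeriv P c (x - p m) * (r m * zetaLin P c (x - p m)
      + ∑ l ∈ Finset.univ.erase m, r l * zetaLin P c (x - p l)
      - ∑ l ∈ Finset.univ.erase m, r l * zetaLin P c (p m - p l))) * Complex.I_sq
  rw [Finset.mul_sum, Finset.mul_sum Finset.univ (fun m => r m * zetaLinDeriv P c (x - p m)),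
    Finset.mul_sum, ← Finset.sum_add_distrib, Finset.sum_congr rfl fun m _ => e m,
    ← Finset.mul_sum, Finset.sum_add_distrib, key, ← Finset.sum_add_distrib, Finset.mul_sum,
    ← Finset.sum_neg_distrib]
  refine Finset.sum_congr rfl fun m _ => ?_
  -- Neutrality again: the products ζζ' cancel the self-interaction r m ^ 2 coming from U U_x.
  have hs : ∑ l ∈ Finset.univ.erase m, r l = -r m := by
    have h1 := Finset.add_sum_erase Finset.univ r (Finset.mem_univ m)
    linear_combination h1 + hr
  rw [hs]
  linear_combination -℘'[P] (x - p m) * hr2 m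

end

/-! ### Propagation of the first-order pole dynamics. -/

section

variable {P : PeriodPair}

/-- A solution of a homogeneous linear ODE which vanishes at one point vanishes. -/
lemma linear_ode_eq_zero {E : Type*} [NormedAddCommGroup E] [NormedSpace ℝ E] [NormedSpace ℂ E]
    {I : Set ℝ} (hI : I.OrdConnected) {A : ℝ → E →L[ℂ] E} (hA : ContinuousOn A I) {f : ℝ → E}
    (hf : ∀ t ∈ I, HasDerivAt f (A t (f t)) t) {t₀ : ℝ} (ht₀ : t₀ ∈ I) (h0 : f t₀ = 0)
    {t : ℝ} (ht : t ∈ I) : f t = 0 := by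
  have hsub : ∀ {a b}, a ∈ I → b ∈ I → Set.Icc a b ⊆ I := fun ha hb => hI.out ha hb
  -- Only compact subintervals give a uniform Lipschitz constant; this is enough to compare f with
  -- the zero solution between t₀ and t.
  have hlip : ∀ {a b}, a ∈ I → b ∈ I →
      ∃ K : NNReal, ∀ s ∈ Set.Icc a b, LipschitzOnWith K (fun x => A s x) Set.univ := by
    intro a b ha hb
    obtain ⟨C, hC⟩ := isCompact_Icc.exists_bound_of_continuousOn (hA.mono (hsub ha hb))
    refine ⟨C.toNNReal, fun s hs => ?_⟩
    refine ((A s).lipschitz.weaken ?_).lipschitzOnWith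
    rw [← NNReal.coe_le_coe, coe_nnnorm]
    exact (hC s hs).trans (Real.le_coe_toNNReal C)
  have hz : ∀ s, HasDerivAt (fun _ : ℝ => (0 : E)) (A s 0) s := fun s => by
    simpa using hasDerivAt_const s (0 : E)
  have hcont : ∀ {a b}, a ∈ I → b ∈ I → ContinuousOn f (Set.Icc a b) := fun ha hb s hs =>
    (hf s (hsub ha hb hs)).continuousAt.continuousWithinAt
  rcases le_total t₀ t with h | h
  · obtain ⟨K, hK⟩ := hlip ht₀ ht
    exact ODE_solution_unique_of_mem_Icc_right (v := fun s x => A s x) (s := fun _ => Set.univ)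
      (g := fun _ => 0) (fun s hs => hK s (Set.Ico_subset_Icc_self hs)) (hcont ht₀ ht)
      (fun s hs => (hf s (hsub ht₀ ht (Set.Ico_subset_Icc_self hs))).hasDerivWithinAt)
      (fun _ _ => trivial) continuousOn_const (fun s _ => (hz s).hasDerivWithinAt)
      (fun _ _ => trivial) h0 ⟨h, le_rfl⟩
  · obtain ⟨K, hK⟩ := hlip ht ht₀
    exact ODE_solution_unique_of_mem_Icc_left (v := fun s x => A s x) (s := fun _ => Set.univ)
      (g := fun _ => 0) (fun s hs => hK s (Set.Ioc_subset_Icc_self hs)) (hcont ht ht₀)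
      (fun s hs => (hf s (hsub ht ht₀ (Set.Ioc_subset_Icc_self hs))).hasDerivWithinAt)
      (fun _ _ => trivial) continuousOn_const (fun s _ => (hz s).hasDerivWithinAt)
      (fun _ _ => trivial) h0 ⟨le_rfl, h⟩

variable {ι : Type*} [Fintype ι] [DecidableEq ι]

/-- If the first-order pole dynamics holds initially and the poles satisfy the second-order
equations, then the first-order dynamics holds for all times. -/
lemma deriv_eq_poleVelocity (c : ℂ) (r : ι → ℂ) (q : ι → ℝ → ℂ) (hr : ∑ m, r m = 0)
    (hr2 : ∀ m, r m ^ 2 = 1) {I : Set ℝ} (hI : I.OrdConnected)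
    (hq : ∀ t ∈ I, ∀ m l, m ≠ l → q m t - q l t ∉ P.lattice)
    (hd : ∀ t ∈ I, ∀ j, DifferentiableAt ℝ (q j) t)
    (hdd : ∀ t ∈ I, ∀ j, HasDerivAt (deriv (q j))
      (-2 * ∑ m ∈ Finset.univ.erase j, (1 + r j * r m) * ℘'[P] (q j t - q m t)) t)
    {t₀ : ℝ} (ht₀ : t₀ ∈ I)
    (h0 : ∀ j, deriv (q j) t₀ = poleVelocity P c r (fun m => q m t₀) j) :
    ∀ t ∈ I, ∀ j, deriv (q j) t = poleVelocity P c r (fun m => q m t) j := by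
  let E : ι → ι → (ι → ℂ) →L[ℂ] (ι → ℂ) := fun j m =>
    (ContinuousLinearMap.single ℂ (fun _ : ι => ℂ) j).comp
      ((ContinuousLinearMap.proj j : (ι → ℂ) →L[ℂ] ℂ) - ContinuousLinearMap.proj m)
  let A : ℝ → (ι → ℂ) →L[ℂ] (ι → ℂ) := fun t => ∑ j, ∑ m ∈ Finset.univ.erase j,
    (-2 * Complex.I * (r m * zetaLinDeriv P c (q j t - q m t))) • E j m
  let D : ℝ → ι → ℂ := fun t j => deriv (q j) t - poleVelocity P c r (fun m => q m t) j
  have hAapp : ∀ t x j, A t x j = -2 * Complex.I * ∑ m ∈ Finset.univ.erase j,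
      r m * (zetaLinDeriv P c (q j t - q m t) * (x j - x m)) := by
    intro t x j
    simp only [A, E, _root_.sum_apply, Finset.sum_apply]
    rw [Finset.sum_eq_single j]
    · rw [Finset.mul_sum]
      refine Finset.sum_congr rfl fun m _ => ?_
      simp
      ring
    · intro k _ hk
      refine Finset.sum_eq_zero fun m _ => ?_
      simp [Pi.single_eq_of_ne hk.symm]
    · simp
  have hAc : ContinuousOn A I := by
    refine continuousOn_finsetSum _ fun j _ => continuousOn_finsetSum _ fun m hm => ?_
    intro t ht
    have h1 : ContinuousAt (fun t => zetaLinDeriv P c (q j t - q m t)) t :=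
      ContinuousAt.comp_of_eq (g := zetaLinDeriv P c) (hasDerivAt_zetaLinDeriv c
        (hq t ht j m (Finset.ne_of_mem_erase hm).symm)).continuousAt
        ((hd t ht j).continuousAt.sub (hd t ht m).continuousAt) rfl
    exact ((continuousAt_const.mul (continuousAt_const.mul h1)).smul
      continuousAt_const).continuousWithinAt
  have hD : ∀ t ∈ I, HasDerivAt D (A t (D t)) t := by
    intro t ht
    rw [hasDerivAt_pi]
    intro j
    have h1 : HasDerivAt (fun t => poleVelocity P c r (fun m => q m t) j)
        (2 * Complex.I * ∑ m ∈ Finset.univ.erase j, r m *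
          (zetaLinDeriv P c (q j t - q m t) * (deriv (q j) t - deriv (q m) t))) t := by
      refine (HasDerivAt.fun_sum fun m hm => ?_).const_mul _
      refine HasDerivAt.const_mul _ ?_
      exact (hasDerivAt_zetaLin c (hq t ht j m
        (Finset.ne_of_mem_erase hm).symm)).comp t
          ((hd t ht j).hasDerivAt.sub (hd t ht m).hasDerivAt)
    refine ((hdd t ht j).sub h1).congr_deriv ?_
    -- The force equals the time derivative of the prescribed velocity with each actual velocity
    -- replaced by the prescribed one. The difference of the two is therefore linear in the defect
    -- D.
    rw [hAapp, ← sum_zetaLinDeriv_mul_poleVelocity_sub c r (fun m => q m t) hr hr2 (hq t ht) j,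
      ← mul_sub, ← Finset.sum_sub_distrib, neg_mul, neg_mul, ← mul_neg, ← Finset.sum_neg_distrib]
    congr 1
    refine Finset.sum_congr rfl fun m _ => ?_
    simp only [D]
    ring
  intro t ht j
  have := linear_ode_eq_zero hI hAc hD ht₀ (by ext j; simp [D, h0]) ht
  exact sub_eq_zero.mp (congrFun this j)

end

/-! ### Separating the kernel from ℘'; the lattice generated by L and 2iδ. -/

section

section general

variable {P : PeriodPair}

variable (P) in
/-- The part of `ζ(t + d) ℘'(t)` which is regular at `t = -d`. -/
def regularPart (c d t : ℂ) : ℂ :=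
  ℘'[P] d * zetaLin P c t + zetaLin P c t * ℘'[P] t - ℘[P] t ^ 2 + zetaLin P c d * ℘'[P] t
    + 2 * ℘[P] d * ℘[P] t + deriv ℘'[P] t / 2
    + (℘'[P] d * zetaLin P c d - ℘[P] d ^ 2 + deriv ℘'[P] d / 2)

/-- This is half of the differentiated addition formula. With t = x' - p and d = p - x the product
of kernel and ℘' becomes a constant multiple of the kernel plus a function of t alone. -/
lemma zetaLin_mul_derivWeierstrassP (c : ℂ) {t d : ℂ} (ht : t ∉ P.lattice) (hd : d ∉ P.lattice)
    (hs : t + d ∉ P.lattice) :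
    zetaLin P c (t + d) * ℘'[P] t = -℘'[P] d * zetaLin P c (t + d) + regularPart P c d t := by
  have := zeta_addition_deriv ht hd hs
  simp only [regularPart, zetaLin]
  linear_combination this / 2

variable (P) in
/-- A primitive of `regularPart` up to a multiple of `zetaLin` and a constant. -/
def regularPrimitive (c d t : ℂ) : ℂ :=
  zetaLin P c t * ℘[P] t + zetaLin P c d * ℘[P] t + ℘'[P] t / 2
    - (c + 2 * ℘[P] d) * zetaLin P c t

variable (P) in
/-- The mean value of `regularPart` up to a multiple of that of `zetaLin`. -/
def regularMean (c d : ℂ) : ℂ :=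
  ℘'[P] d * zetaLin P c d - ℘[P] d ^ 2 + deriv ℘'[P] d / 2 - c * (c + 2 * ℘[P] d)

/-- Differentiating the product of `zetaLin` and ℘ produces the terms ζ℘' - ℘² together with an
extra -c ℘. The multiple of `zetaLin` in the primitive absorbs this and 2 ℘(d) ℘, at the price of
the constant c (c + 2 ℘(d)). -/
lemma hasDerivAt_regularPrimitive (c d : ℂ) {t : ℂ} (ht : t ∉ P.lattice) :
    HasDerivAt (regularPrimitive P c d)
      (regularPart P c d t - ℘'[P] d * zetaLin P c t - regularMean P c d) t := by
  have h1 := hasDerivAt_zetaLin c ht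
  have h2 := hasDerivAt_weierstrassP ht
  have h3 := hasDerivAt_derivWeierstrassP ht
  have h := (((h1.mul h2).add (h2.const_mul (zetaLin P c d))).add (h3.div_const 2)).sub
    (h1.const_mul (c + 2 * ℘[P] d))
  refine h.congr_deriv ?_
  simp only [regularPart, regularMean, zetaLinDeriv]
  ring

lemma continuousAt_deriv_derivWeierstrassP {t : ℂ} (ht : t ∉ P.lattice) :
    ContinuousAt (deriv ℘'[P]) t :=
  (P.analyticOnNhd_derivWeierstrassP.deriv t ht).continuousAt

lemma continuousAt_regularPart (c d : ℂ) {t : ℂ} (ht : t ∉ P.lattice) :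
    ContinuousAt (regularPart P c d) t := by
  have h1 := (hasDerivAt_zetaLin c ht).continuousAt
  have h2 := (hasDerivAt_weierstrassP ht).continuousAt
  have h3 := (hasDerivAt_derivWeierstrassP ht).continuousAt
  have h4 := continuousAt_deriv_derivWeierstrassP ht
  unfold regularPart
  fun_prop

end general

variable {L δ : ℝ} (hL : 0 < L) (hδ : 0 < δ)

lemma mem_lattice_periods {z : ℂ} : z ∈ (periods L δ hL hδ).lattice ↔
    ∃ m n : ℤ, z = m * L + n * (2 * Complex.I * δ) := by
  rw [PeriodPair.mem_lattice]
  simp only [periods, eq_comm]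

lemma real_mem_lattice (n : ℤ) : ((n * L : ℝ) : ℂ) ∈ (periods L δ hL hδ).lattice :=
  (mem_lattice_periods hL hδ).mpr ⟨n, 0, by push_cast; ring⟩

lemma L_mem_lattice : (L : ℂ) ∈ (periods L δ hL hδ).lattice :=
  (periods L δ hL hδ).ω₁_mem_lattice

lemma two_I_delta_mem_lattice : 2 * Complex.I * (δ : ℂ) ∈ (periods L δ hL hδ).lattice :=
  (periods L δ hL hδ).ω₂_mem_lattice

lemma exists_im_eq_of_mem_lattice {z : ℂ} (h : z ∈ (periods L δ hL hδ).lattice) :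
    ∃ n : ℤ, z.im = 2 * δ * n := by
  obtain ⟨m, n, rfl⟩ := (mem_lattice_periods hL hδ).mp h
  exact ⟨n, by simp; ring⟩

lemma notMem_lattice_of_im {z : ℂ} (n : ℤ) (h1 : 2 * δ * n < z.im) (h2 : z.im < 2 * δ * (n + 1)) :
    z ∉ (periods L δ hL hδ).lattice := by
  intro h
  obtain ⟨k, hk⟩ := exists_im_eq_of_mem_lattice hL hδ h
  rw [hk] at h1 h2
  have h1' : (n : ℝ) < k := lt_of_mul_lt_mul_left h1 (by positivity)
  have h2' : (k : ℝ) < n + 1 := lt_of_mul_lt_mul_left h2 (by positivity)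
  norm_cast at h1' h2'
  omega

lemma eq_real_of_real_mem_lattice {x : ℝ} (h : (x : ℂ) ∈ (periods L δ hL hδ).lattice) :
    ∃ n : ℤ, x = n * L := by
  obtain ⟨m, n, hmn⟩ := (mem_lattice_periods hL hδ).mp h
  have := congrArg Complex.re hmn
  exact ⟨m, by simpa using this⟩

variable (L δ) in
/-- The slope of the linear term in `zeta₁`. -/
def slope₁ : ℂ := weierstrassZeta (periods L δ hL hδ) ((periods L δ hL hδ).ω₁ / 2)
  / ((periods L δ hL hδ).ω₁ / 2)

variable (L δ) in
/-- The slope of the linear term in `zeta₂`. -/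
def slope₂ : ℂ := weierstrassZeta (periods L δ hL hδ) ((periods L δ hL hδ).ω₂ / 2)
  / ((periods L δ hL hδ).ω₂ / 2)

lemma zeta₁_eq : zeta₁ (periods L δ hL hδ) = zetaLin (periods L δ hL hδ) (slope₁ L δ hL hδ) := rfl

lemma zeta₂_eq : zeta₂ (periods L δ hL hδ) = zetaLin (periods L δ hL hδ) (slope₂ L δ hL hδ) := rfl

/-- The slope is chosen so that the linear term cancels the quasi-period 2 ζ(ω₁) exactly. The slope
of ζ₂ does the same for 2iδ. -/
lemma zeta₁_add_L {z : ℂ} (hz : z ∉ (periods L δ hL hδ).lattice) :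
    zetaLin (periods L δ hL hδ) (slope₁ L δ hL hδ) (z + L)
      = zetaLin (periods L δ hL hδ) (slope₁ L δ hL hδ) z := by
  have h := zeta_add_period (periods L δ hL hδ).ω₁_mem_lattice
    (periods L δ hL hδ).ω₁_div_two_notMem_lattice hz
  have e : (periods L δ hL hδ).ω₁ = (L : ℂ) := rfl
  have hL' : (L : ℂ) ≠ 0 := by exact_mod_cast hL.ne'
  simp only [zetaLin, slope₁]
  rw [e] at h ⊢
  rw [h]
  field_simp
  ring

lemma zeta₂_add_two_I_delta {z : ℂ} (hz : z ∉ (periods L δ hL hδ).lattice) :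
    zetaLin (periods L δ hL hδ) (slope₂ L δ hL hδ) (z + 2 * Complex.I * δ)
      = zetaLin (periods L δ hL hδ) (slope₂ L δ hL hδ) z := by
  have h := zeta_add_period (periods L δ hL hδ).ω₂_mem_lattice
    (periods L δ hL hδ).ω₂_div_two_notMem_lattice hz
  have e : (periods L δ hL hδ).ω₂ = 2 * Complex.I * δ := rfl
  have hδ' : (δ : ℂ) ≠ 0 := by exact_mod_cast hδ.ne'
  simp only [zetaLin, slope₂]
  rw [e] at h ⊢
  rw [h]
  field_simp [Complex.I_ne_zero]
  ring

lemma integral_inv_add_mul_I {a c : ℝ} (hc : 0 < c) :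
    ∫ x in (-a)..a, 1 / ((x : ℂ) + c * Complex.I)
      = Complex.log (a + c * Complex.I) - Complex.log (-a + c * Complex.I) := by
  have hs : ∀ x : ℝ, (x : ℂ) + c * Complex.I ∈ Complex.slitPlane := fun x => by
    right; simpa using hc.ne'
  have hd : ∀ x : ℝ, HasDerivAt (fun x : ℝ => Complex.log (x + c * Complex.I))
      (1 / ((x : ℂ) + c * Complex.I)) x := fun x =>
    (Complex.ofRealCLM.hasDerivAt.add_const _).clog_real (hs x)
  rw [intervalIntegral.integral_eq_sub_of_hasDerivAt (fun x _ => hd x)]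
  · simp
  · refine Continuous.intervalIntegrable ?_ _ _
    refine continuous_const.div (by fun_prop) fun x h => ?_
    have := hs x
    rw [h] at this
    simp at this

lemma I_mul_integral_inv {a c : ℝ} (ha : 0 < a) (ε : ℝ) :
    ∫ y in (0 : ℝ)..c, ε * Complex.I / ((a : ℂ) + ε * y * Complex.I)
      = Complex.log (a + ε * c * Complex.I) - Complex.log a := by
  have hs : ∀ y : ℝ, (a : ℂ) + ε * y * Complex.I ∈ Complex.slitPlane := fun y => by
    left; simpa using ha
  have hd : ∀ y : ℝ, HasDerivAt (fun y : ℝ => Complex.log (a + ε * y * Complex.I))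
      (ε * Complex.I / ((a : ℂ) + ε * y * Complex.I)) y := fun y => by
    refine HasDerivAt.clog_real ?_ (hs y)
    have h := (((Complex.ofRealCLM.hasDerivAt (x := y)).const_mul (ε : ℂ)).mul_const
      Complex.I).const_add (a : ℂ)
    simpa using! h
  rw [intervalIntegral.integral_eq_sub_of_hasDerivAt (fun x _ => hd x)]
  · simp
  · refine Continuous.intervalIntegrable ?_ _ _
    refine continuous_const.div (by fun_prop) fun x h => ?_
    have := hs x
    rw [h] at this
    simp at this

end

/-! ### Integrals of ζ₁ along horizontal lines. -/

section

variable {L δ : ℝ} (hL : 0 < L) (hδ : 0 < δ)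

variable (L δ) in
/-- The integral of `ζ₁` over one period of a horizontal line. -/
def lineIntegral (q : ℂ) : ℂ :=
  ∫ x in (-(L / 2))..(L / 2), zetaLin (periods L δ hL hδ) (slope₁ L δ hL hδ) ((x : ℂ) + q)

lemma real_add_notMem {q : ℂ} (hq : ∀ n : ℤ, q.im ≠ 2 * δ * n) (x : ℝ) :
    (x : ℂ) + q ∉ (periods L δ hL hδ).lattice := by
  intro h
  obtain ⟨n, hn⟩ := exists_im_eq_of_mem_lattice hL hδ h
  exact hq n (by simpa using hn)

lemma im_ne_of_pos {q : ℂ} (h1 : 0 < q.im) (h2 : q.im < 2 * δ) (n : ℤ) : q.im ≠ 2 * δ * n := by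
  intro h
  rw [h] at h1 h2
  have hδ : 0 < δ := by linarith
  have h1' : (0 : ℝ) < n := by
    by_contra hn
    nlinarith [not_lt.mp hn]
  have h2' : (n : ℝ) < 1 := by
    by_contra hn
    nlinarith [not_lt.mp hn]
  norm_cast at h1' h2'
  omega

lemma zetaLin_line_periodic {q : ℂ} (hq : ∀ n : ℤ, q.im ≠ 2 * δ * n) :
    Function.Periodic (fun x : ℝ =>
      zetaLin (periods L δ hL hδ) (slope₁ L δ hL hδ) ((x : ℂ) + q)) L := by
  intro x
  have := zeta₁_add_L hL hδ (real_add_notMem hL hδ hq x)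
  simp only [← this]
  congr 1
  push_cast
  ring

lemma lineIntegral_add_real {q : ℂ} (hq : ∀ n : ℤ, q.im ≠ 2 * δ * n) (s : ℝ) :
    lineIntegral L δ hL hδ (q + s) = lineIntegral L δ hL hδ q := by
  have h := (zetaLin_line_periodic hL hδ hq).intervalIntegral_add_eq (-(L / 2) + s) (-(L / 2))
  have h2 := intervalIntegral.integral_comp_add_right (a := -(L / 2)) (b := L / 2)
    (fun x : ℝ => zetaLin (periods L δ hL hδ) (slope₁ L δ hL hδ) ((x : ℂ) + q)) s
  have e1 : -(L / 2) + s + L = L / 2 + s := by ring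
  have e2 : -(L / 2) + L = L / 2 := by ring
  rw [e1, e2] at h
  rw [lineIntegral, lineIntegral, ← h, ← h2]
  congr with x
  congr 1
  push_cast
  ring

lemma lineIntegral_neg (q : ℂ) : lineIntegral L δ hL hδ (-q) = -lineIntegral L δ hL hδ q := by
  have h := intervalIntegral.integral_comp_neg (a := -(L / 2)) (b := L / 2)
    (fun x : ℝ => zetaLin (periods L δ hL hδ) (slope₁ L δ hL hδ) ((x : ℂ) + -q))
  rw [neg_neg] at h
  rw [lineIntegral, ← h, lineIntegral, ← intervalIntegral.integral_neg]
  congr with x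
  rw [← zetaLin_neg]
  congr 1
  push_cast
  ring

lemma eq_zero_of_mem_lattice_of_rect {c : ℝ} (hc : c < 2 * δ) {z : ℂ}
    (hz : z ∈ (periods L δ hL hδ).lattice) (hre : |z.re| ≤ L / 2) (him : 0 ≤ z.im)
    (him' : z.im ≤ c) : z = 0 := by
  obtain ⟨m, n, rfl⟩ := (mem_lattice_periods hL hδ).mp hz
  have h1 : |(m : ℝ) * L| ≤ L / 2 := by simpa using hre
  have h2 : 0 ≤ (n : ℝ) * (2 * δ) := by simpa using him
  have h3 : (n : ℝ) * (2 * δ) ≤ c := by simpa using him'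
  have hm : |(m : ℝ)| < 1 := by
    rw [abs_mul, abs_of_pos hL] at h1
    by_contra hcon
    nlinarith [not_lt.mp hcon]
  have hm0 : m = 0 := by
    rw [← Int.abs_lt_one_iff]
    exact_mod_cast hm
  have hn : (n : ℝ) < 1 := by
    by_contra hcon
    nlinarith [not_lt.mp hcon]
  have hn' : (-1 : ℝ) < n := by
    by_contra hcon
    nlinarith [not_lt.mp hcon]
  have hn0 : n = 0 := by
    norm_cast at hn hn'
    omega
  simp [hm0, hn0]

lemma zetaLin_eq_zetaReg_add (P : PeriodPair) (c z : ℂ) :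
    zetaLin P c z = (zetaReg P z - c * z) + 1 / z := by
  rw [zetaLin, zeta_eq_zetaReg_add]; ring

lemma log_neg_of_im_neg {z : ℂ} (hz : z.im < 0) :
    Complex.log (-z) = Complex.log z + Real.pi * Complex.I := by
  simp only [Complex.log, norm_neg, Complex.arg_neg_eq_arg_add_pi_of_im_neg hz]
  push_cast
  ring

/-- Cauchy's theorem for g = ζ₁ - 1/z on the rectangle with base [-L/2, L/2] and height c, in which
g has no pole. On the base g is odd and integrates to 0. On the vertical sides the contributions of
ζ₁ cancel by L-periodicity, leaving those of 1/z. All remaining terms are logarithms, and they add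
up to -πi, half a residue. -/
lemma lineIntegral_mul_I {c : ℝ} (hc : 0 < c) (hc' : c < 2 * δ) :
    lineIntegral L δ hL hδ (c * Complex.I) = -(Real.pi * Complex.I) := by
  set P := periods L δ hL hδ
  set k := slope₁ L δ hL hδ
  set a : ℝ := L / 2 with ha
  have ha0 : 0 < a := by positivity
  let g : ℂ → ℂ := fun z => zetaReg P z - k * z
  have hdiff : ∀ z : ℂ, |z.re| ≤ a → 0 ≤ z.im → z.im ≤ c → DifferentiableAt ℂ g z := by
    intro z h1 h2 h3
    have hz : z ∈ ((P.lattice : Set ℂ) \ {0})ᶜ := fun h =>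
      h.2 (eq_zero_of_mem_lattice_of_rect hL hδ hc' h.1 h1 h2 h3)
    exact (hasDerivAt_zetaReg P hz).differentiableAt.sub (by fun_prop)
  have hrect := Complex.integral_boundary_rect_eq_zero_of_differentiableOn g
    (-a : ℂ) (a + c * Complex.I) (by
      intro z hz
      simp only [Complex.mem_reProdIm, Complex.neg_re, Complex.ofReal_re, Complex.add_re,
        Complex.mul_re, Complex.I_re, mul_zero, Complex.ofReal_im, Complex.I_im, mul_one,
        Complex.neg_im, neg_zero, Complex.add_im, Complex.mul_im, add_zero, zero_add,
        sub_self] at hz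
      rw [Set.uIcc_of_le (by linarith), Set.uIcc_of_le hc.le] at hz
      exact (hdiff z (abs_le.mpr hz.1) hz.2.1 hz.2.2).differentiableWithinAt)
  simp only [Complex.neg_re, Complex.ofReal_re, Complex.add_re,
        Complex.mul_re, Complex.I_re, mul_zero, Complex.ofReal_im, Complex.I_im, mul_one,
        Complex.neg_im, neg_zero, Complex.add_im, Complex.mul_im, add_zero, zero_add,
        sub_self, Complex.ofReal_zero, zero_mul, Complex.ofReal_neg, smul_eq_mul] at hrect
  have hbot : ∫ x in (-a)..a, g x = 0 := by
    have h := intervalIntegral.integral_comp_neg (a := -a) (b := a) (fun x : ℝ => g x)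
    rw [neg_neg] at h
    have hodd : ∀ x : ℝ, g ((-x : ℝ) : ℂ) = -g x := fun x => by
      simp only [g, Complex.ofReal_neg, zetaReg_neg]; ring
    simp only [hodd, intervalIntegral.integral_neg] at h
    linear_combination -h / 2
  have hsides : ∀ y ∈ Set.uIcc 0 c, g (a + y * Complex.I) - g (-a + y * Complex.I)
      = -(1 / (a + y * Complex.I)) + 1 / (-a + y * Complex.I) := by
    intro y hy
    rw [Set.uIcc_of_le hc.le] at hy
    have hnot : (-a : ℂ) + y * Complex.I ∉ P.lattice := by
      intro h
      have := eq_zero_of_mem_lattice_of_rect hL hδ hc' h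
        (by simp [abs_of_pos ha0, ha.le]) (by simpa using hy.1) (by simpa using hy.2)
      have := congrArg Complex.re this
      simp at this
      linarith
    have hper := zeta₁_add_L hL hδ hnot
    have e : (-a : ℂ) + y * Complex.I + L = a + y * Complex.I := by
      rw [ha]; push_cast; ring
    rw [e, zetaLin_eq_zetaReg_add, zetaLin_eq_zetaReg_add] at hper
    simp only [g]
    linear_combination hper
  have hint : ∀ s : ℝ, |s| ≤ a →
      IntervalIntegrable (fun y : ℝ => g (s + y * Complex.I)) volume 0 c := by
    intro s hs
    refine ContinuousOn.intervalIntegrable fun y hy => ?_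
    rw [Set.uIcc_of_le hc.le] at hy
    refine (ContinuousAt.comp_of_eq (g := g) (f := fun y : ℝ => (s : ℂ) + y * Complex.I)
      (hdiff _ ?_ ?_ ?_).continuousAt (by fun_prop) rfl).continuousWithinAt
    · simpa using hs
    · simpa using hy.1
    · simpa using hy.2
  have hside : Complex.I * (∫ y in (0 : ℝ)..c, g (a + y * Complex.I))
      - Complex.I * (∫ y in (0 : ℝ)..c, g (-a + y * Complex.I))
      = -(Complex.log (a + c * Complex.I) - Complex.log a)
        + (Complex.log (a - c * Complex.I) - Complex.log a) := by
    have h1 := hint a (abs_of_pos ha0).le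
    have h2 := hint (-a) (by rw [abs_neg, abs_of_pos ha0])
    rw [Complex.ofReal_neg] at h2
    have l1 := I_mul_integral_inv (c := c) ha0 1
    have l2 := I_mul_integral_inv (c := c) ha0 (-1)
    have i1 : ∀ ε : ℝ, IntervalIntegrable
        (fun y : ℝ => ε * Complex.I / ((a : ℂ) + ε * y * Complex.I)) volume 0 c := by
      intro ε
      refine Continuous.intervalIntegrable (continuous_const.div (by fun_prop) fun y h => ?_) _ _
      have := congrArg Complex.re h
      simp at this
      exact ha0.ne' this
    have i1' := i1 1
    have i2' := i1 (-1)
    simp only [Complex.ofReal_one, one_mul, Complex.ofReal_neg, neg_mul, ← sub_eq_add_neg]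
      at l1 l2 i1' i2'
    rw [← mul_sub, ← intervalIntegral.integral_sub h1 h2, intervalIntegral.integral_congr hsides,
      ← l1, ← l2, neg_add_eq_sub, ← intervalIntegral.integral_sub i2' i1',
      ← intervalIntegral.integral_const_mul]
    refine intervalIntegral.integral_congr fun y _ => ?_
    have e : (-a : ℂ) + y * Complex.I = -(a - y * Complex.I) := by ring
    simp only [e, inv_neg, div_eq_mul_inv]
    ring
  have hI0 : IntervalIntegrable (fun x : ℝ => 1 / ((x : ℂ) + c * Complex.I)) volume (-a) a := by
    refine Continuous.intervalIntegrable (continuous_const.div (by fun_prop) fun y h => ?_) _ _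
    have := congrArg Complex.im h
    simp at this
    exact hc.ne' this
  have hI1 : IntervalIntegrable (fun x : ℝ => g ((x : ℂ) + c * Complex.I)) volume (-a) a := by
    refine ContinuousOn.intervalIntegrable fun x hx => ?_
    rw [Set.uIcc_of_le (by linarith)] at hx
    refine (ContinuousAt.comp_of_eq (g := g) (f := fun x : ℝ => (x : ℂ) + c * Complex.I)
      (hdiff _ ?_ ?_ ?_).continuousAt (by fun_prop) rfl).continuousWithinAt
    · simpa using abs_le.mpr hx
    · simpa using hc.le
    · simp
  have hsplit : lineIntegral L δ hL hδ (c * Complex.I)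
      = (∫ x in (-a)..a, g ((x : ℂ) + c * Complex.I))
        + ∫ x in (-a)..a, 1 / ((x : ℂ) + c * Complex.I) := by
    rw [← intervalIntegral.integral_add hI1 hI0, lineIntegral]
    congr with x
    rw [zetaLin_eq_zetaReg_add]
  -- The whole value of the integral comes from this change of branch of the principal logarithm;
  -- every other logarithm cancels.
  have hlog : Complex.log (-a + c * Complex.I)
      = Complex.log (a - c * Complex.I) + Real.pi * Complex.I := by
    rw [← log_neg_of_im_neg (by simpa using hc)]
    congr 1
    ring
  rw [hsplit, integral_inv_add_mul_I hc, hlog]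
  rw [hbot] at hrect
  linear_combination -hrect + hside

lemma lineIntegral_of_im_pos {q : ℂ} (h1 : 0 < q.im) (h2 : q.im < 2 * δ) :
    lineIntegral L δ hL hδ q = -(Real.pi * Complex.I) := by
  rw [← lineIntegral_mul_I hL hδ h1 h2, ← lineIntegral_add_real hL hδ (q := q.im * Complex.I)
    (by simpa using im_ne_of_pos h1 h2) q.re]
  congr 1
  rw [add_comm]
  exact (Complex.re_add_im q).symm

lemma lineIntegral_of_im_neg {q : ℂ} (h1 : q.im < 0) (h2 : -(2 * δ) < q.im) :
    lineIntegral L δ hL hδ q = Real.pi * Complex.I := by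
  have := lineIntegral_of_im_pos hL hδ (q := -q) (by simpa using h1) (by simp; linarith)
  rw [lineIntegral_neg] at this
  exact neg_injective this

end

/-! ### Principal values and the integral of the regular part. -/

section

variable {L δ : ℝ} (hL : 0 < L) (hδ : 0 < δ)

lemma measurableSet_truncatedInterval (L x ε : ℝ) : MeasurableSet (truncatedInterval L x ε) := by
  have : {x' : ℝ | ∀ n : ℤ, ε < |x' - x - n * L|} = ⋂ n : ℤ, {x' : ℝ | ε < |x' - x - n * L|} := by
    ext; simp
  have hm : MeasurableSet {x' : ℝ | ∀ n : ℤ, ε < |x' - x - n * L|} := by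
    rw [this]
    exact MeasurableSet.iInter fun n => measurableSet_lt measurable_const (by fun_prop)
  exact measurableSet_Icc.inter hm

/-- Weak inequalities make the set compact. For ε > 0 the kernel is continuous on it, hence
integrable on the smaller truncated interval. -/
lemma isCompact_closedTruncatedInterval (L x ε : ℝ) :
    IsCompact (Set.Icc (-(L / 2)) (L / 2) ∩ {x' : ℝ | ∀ n : ℤ, ε ≤ |x' - x - n * L|}) := by
  refine isCompact_Icc.inter_right ?_
  have : {x' : ℝ | ∀ n : ℤ, ε ≤ |x' - x - n * L|} = ⋂ n : ℤ, {x' : ℝ | ε ≤ |x' - x - n * L|} := by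
    ext; simp
  rw [this]
  exact isClosed_iInter fun n => isClosed_le continuous_const (by fun_prop)

lemma truncatedInterval_subset (L x ε : ℝ) : truncatedInterval L x ε ⊆
    Set.Icc (-(L / 2)) (L / 2) ∩ {x' : ℝ | ∀ n : ℤ, ε ≤ |x' - x - n * L|} :=
  fun _ h => ⟨h.1, fun n => (h.2 n).le⟩

lemma notMem_lattice_of_dist {y ε : ℝ} (hε : 0 < ε) (h : ∀ n : ℤ, ε ≤ |y - n * L|) :
    (y : ℂ) ∉ (periods L δ hL hδ).lattice := by
  intro hy
  obtain ⟨n, hn⟩ := eq_real_of_real_mem_lattice hL hδ hy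
  have := h n
  rw [hn, sub_self, abs_zero] at this
  linarith

/-- The principal value of the integral of `ζ₁` over a period vanishes, as does each truncation. -/
lemma setIntegral_truncated_zetaLin (x ε : ℝ) (hε : 0 < ε) :
    ∫ x' in truncatedInterval L x ε,
      zetaLin (periods L δ hL hδ) (slope₁ L δ hL hδ) ((x' : ℂ) - x) = 0 := by
  classical
  -- The truncated kernel, extended by zero, is still odd and L-periodic because all translates of
  -- the singularity are cut out symmetrically. Its integral over any period therefore vanishes.
  let h : ℝ → ℂ := fun y => if ∀ n : ℤ, ε < |y - n * L| then
    zetaLin (periods L δ hL hδ) (slope₁ L δ hL hδ) y else 0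
  have hper : Function.Periodic h L := by
    intro y
    have hiff : (∀ n : ℤ, ε < |y + L - n * L|) ↔ ∀ n : ℤ, ε < |y - n * L| := by
      constructor
      · intro H n
        have := H (n + 1)
        rwa [show y + L - ((n + 1 : ℤ) : ℝ) * L = y - n * L by push_cast; ring] at this
      · intro H n
        have := H (n - 1)
        rwa [show y - ((n - 1 : ℤ) : ℝ) * L = y + L - n * L by push_cast; ring] at this
    by_cases hy : ∀ n : ℤ, ε < |y - n * L|
    · simp only [h, if_pos hy, if_pos (hiff.mpr hy), Complex.ofReal_add]
      exact zeta₁_add_L hL hδ (notMem_lattice_of_dist hL hδ hε fun n => (hy n).le)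
    · simp only [h, if_neg hy, if_neg (fun H => hy (hiff.mp H))]
  have hodd : ∀ y, h (-y) = -h y := by
    intro y
    have hiff : (∀ n : ℤ, ε < |-y - n * L|) ↔ ∀ n : ℤ, ε < |y - n * L| := by
      constructor
      · intro H n
        have := H (-n)
        rwa [← abs_neg, show -(-y - ((-n : ℤ) : ℝ) * L) = y - n * L by push_cast; ring] at this
      · intro H n
        have := H (-n)
        rwa [← abs_neg, show -(y - ((-n : ℤ) : ℝ) * L) = -y - n * L by push_cast; ring] at this
    by_cases hy : ∀ n : ℤ, ε < |y - n * L|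
    · simp only [h, if_pos hy, if_pos (hiff.mpr hy), Complex.ofReal_neg, zetaLin_neg]
    · simp only [h, if_neg hy, if_neg (fun H => hy (hiff.mp H)), neg_zero]
  have hzero : ∫ y in (-(L / 2))..(L / 2), h y = 0 := by
    have e := intervalIntegral.integral_comp_neg (a := -(L / 2)) (b := L / 2) h
    rw [neg_neg] at e
    simp only [hodd, intervalIntegral.integral_neg] at e
    linear_combination -e / 2
  have hshift : ∫ x' in (-(L / 2))..(L / 2), h (x' - x) = 0 := by
    rw [intervalIntegral.integral_comp_sub_right h x, ← hzero]
    have e := hper.intervalIntegral_add_eq (-(L / 2) - x) (-(L / 2))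
    rwa [show -(L / 2) - x + L = L / 2 - x by ring, show -(L / 2) + L = L / 2 by ring] at e
  rw [intervalIntegral.integral_of_le (by linarith), ← integral_Icc_eq_integral_Ioc] at hshift
  rw [← hshift, ← integral_indicator (measurableSet_truncatedInterval L x ε),
    ← integral_indicator measurableSet_Icc]
  congr with x'
  by_cases h1 : x' ∈ Set.Icc (-(L / 2)) (L / 2)
  · by_cases h2 : ∀ n : ℤ, ε < |x' - x - n * L|
    · rw [Set.indicator_of_mem (show x' ∈ truncatedInterval L x ε from ⟨h1, h2⟩),
        Set.indicator_of_mem h1]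
      simp only [h, if_pos h2, Complex.ofReal_sub]
    · rw [Set.indicator_of_notMem (fun H => h2 H.2), Set.indicator_of_mem h1]
      simp only [h, if_neg h2]
  · rw [Set.indicator_of_notMem (fun H => h1 H.1), Set.indicator_of_notMem h1]

lemma tendsto_setIntegral_truncated {L : ℝ} (hL : 0 < L) {R : ℝ → ℂ} (hR : Continuous R) (x : ℝ) :
    Tendsto (fun ε : ℝ => ∫ x' in truncatedInterval L x ε, R x') (𝓝[>] 0)
      (𝓝 (∫ x' in (-(L / 2))..(L / 2), R x')) := by
  rw [intervalIntegral.integral_of_le (by linarith), ← integral_Icc_eq_integral_Ioc,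
    ← integral_indicator measurableSet_Icc]
  simp_rw [← fun ε => integral_indicator (f := R) (μ := volume)
    (measurableSet_truncatedInterval L x ε)]
  refine tendsto_integral_filter_of_dominated_convergence
    (Set.indicator (Set.Icc (-(L / 2)) (L / 2)) fun x' => ‖R x'‖) ?_ ?_ ?_ ?_
  · exact .of_forall fun ε => (hR.aestronglyMeasurable).indicator
      (measurableSet_truncatedInterval L x ε)
  · refine .of_forall fun ε => .of_forall fun x' => ?_
    rw [norm_indicator_eq_indicator_norm]
    exact Set.indicator_le_indicator_of_subset (fun _ h => h.1) (fun _ => norm_nonneg _) x'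
  · exact (integrable_indicator_iff measurableSet_Icc).mpr
      (hR.norm.continuousOn.integrableOn_compact isCompact_Icc)
  · have hcount : (Set.range fun n : ℤ => x + n * L).Countable := Set.countable_range _
    filter_upwards [hcount.ae_notMem volume] with x' hx'
    -- An auxiliary lattice with δ = 1: its closedness gives a positive lower bound on the distance
    -- from x' - x to all nL at once, so x' belongs to every truncation with small ε.
    have hnot : ((x' - x : ℝ) : ℂ) ∉ (periods L 1 hL one_pos).lattice := by
      intro h
      obtain ⟨n, hn⟩ := eq_real_of_real_mem_lattice hL one_pos h
      exact hx' ⟨n, by simp only; linarith⟩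
    obtain ⟨r, hr, hball⟩ := Metric.isOpen_iff.mp
      (periods L 1 hL one_pos).isClosed_lattice.isOpen_compl _ hnot
    refine tendsto_const_nhds.congr' ?_
    filter_upwards [Ioo_mem_nhdsGT hr] with ε hε
    by_cases h1 : x' ∈ Set.Icc (-(L / 2)) (L / 2)
    · rw [Set.indicator_of_mem h1, Set.indicator_of_mem]
      refine ⟨h1, fun n => ?_⟩
      by_contra hcon
      refine hball (show ((n * L : ℝ) : ℂ) ∈ Metric.ball _ _ from ?_) (real_mem_lattice hL one_pos n)
      rw [Metric.mem_ball, dist_comm, dist_eq_norm, ← Complex.ofReal_sub, Complex.norm_real,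
        Real.norm_eq_abs]
      exact (not_lt.mp hcon).trans_lt hε.2
    · rw [Set.indicator_of_notMem h1, Set.indicator_of_notMem (fun H => h1 H.1)]

/-- The principal value integral against `ζ₁`, after the pole at `x` has been split off. -/
lemma hasT_of_decomposition {f R : ℝ → ℂ} {x : ℝ} {A : ℂ} (hR : Continuous R)
    (h : ∀ x' : ℝ, (x' : ℂ) - x ∉ (periods L δ hL hδ).lattice →
      zetaLin (periods L δ hL hδ) (slope₁ L δ hL hδ) ((x' : ℂ) - x) * f x'
        = A * zetaLin (periods L δ hL hδ) (slope₁ L δ hL hδ) ((x' : ℂ) - x) + R x') :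
    HasT L δ hL hδ f x (1 / (Real.pi : ℂ) * ∫ x' in (-(L / 2))..(L / 2), R x') := by
  have hnot : ∀ {ε : ℝ}, 0 < ε → ∀ x' ∈ Set.Icc (-(L / 2)) (L / 2) ∩
      {x' : ℝ | ∀ n : ℤ, ε ≤ |x' - x - n * L|},
      (x' : ℂ) - x ∉ (periods L δ hL hδ).lattice := by
    intro ε hε x' hx'
    rw [← Complex.ofReal_sub]
    exact notMem_lattice_of_dist hL hδ hε hx'.2
  have hZ : ∀ ε : ℝ, 0 < ε → IntegrableOn (fun x' : ℝ =>
      zetaLin (periods L δ hL hδ) (slope₁ L δ hL hδ) ((x' : ℂ) - x))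
      (truncatedInterval L x ε) := by
    intro ε hε
    refine IntegrableOn.mono_set (ContinuousOn.integrableOn_compact
      (isCompact_closedTruncatedInterval L x ε) fun x' hx' => ?_) (truncatedInterval_subset L x ε)
    exact (ContinuousAt.comp_of_eq (f := fun x' : ℝ => (x' : ℂ) - x)
      (hasDerivAt_zetaLin (slope₁ L δ hL hδ) (hnot hε x' hx')).continuousAt
      (by fun_prop) rfl).continuousWithinAt
  have hRi : ∀ ε : ℝ, IntegrableOn R (truncatedInterval L x ε) := fun ε =>
    (hR.continuousOn.integrableOn_compact isCompact_Icc).mono_set fun _ h => h.1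
  have heq : ∀ ε : ℝ, 0 < ε → Set.EqOn
      (fun x' : ℝ => zeta₁ (periods L δ hL hδ) ((x' : ℂ) - x) * f x')
      (fun x' : ℝ => A * zetaLin (periods L δ hL hδ) (slope₁ L δ hL hδ) ((x' : ℂ) - x) + R x')
      (truncatedInterval L x ε) := fun ε hε x' hx' =>
    h x' (hnot hε x' (truncatedInterval_subset L x ε hx'))
  refine ⟨fun ε hε => ?_, ?_⟩
  · have hint : IntegrableOn _ (truncatedInterval L x ε) := ((hZ ε hε).const_mul A).add (hRi ε)
    exact hint.congr_fun (heq ε hε).symm (measurableSet_truncatedInterval L x ε)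
  · refine ((tendsto_setIntegral_truncated hL hR x).const_mul _).congr' ?_
    filter_upwards [self_mem_nhdsWithin] with ε hε
    rw [setIntegral_congr_fun (measurableSet_truncatedInterval L x ε) (heq ε hε),
      integral_add ((hZ ε hε).const_mul A) (hRi ε), integral_const_mul,
      setIntegral_truncated_zetaLin hL hδ x ε hε, mul_zero, zero_add]

lemma continuous_comp_line {g : ℂ → ℂ} {q : ℂ}
    (hg : ∀ z ∉ (periods L δ hL hδ).lattice, ContinuousAt g z)
    (hq : ∀ n : ℤ, q.im ≠ 2 * δ * n) : Continuous fun x : ℝ => g ((x : ℂ) + q) := by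
  refine continuous_iff_continuousAt.mpr fun x => ?_
  exact ContinuousAt.comp_of_eq (f := fun x : ℝ => (x : ℂ) + q)
    (hg _ (real_add_notMem hL hδ hq x)) (by fun_prop) rfl

lemma continuous_regularPart_line (d : ℂ) {q : ℂ} (hq : ∀ n : ℤ, q.im ≠ 2 * δ * n) :
    Continuous fun x : ℝ =>
      regularPart (periods L δ hL hδ) (slope₁ L δ hL hδ) d ((x : ℂ) + q) :=
  continuous_comp_line hL hδ (fun _ hz => continuousAt_regularPart _ d hz) hq

lemma continuous_zetaLin_line {q : ℂ} (hq : ∀ n : ℤ, q.im ≠ 2 * δ * n) :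
    Continuous fun x : ℝ =>
      zetaLin (periods L δ hL hδ) (slope₁ L δ hL hδ) ((x : ℂ) + q) :=
  continuous_comp_line hL hδ (fun _ hz => (hasDerivAt_zetaLin _ hz).continuousAt) hq

/-- The primitive is L-periodic, so its boundary terms cancel and only the multiple of ζ₁ and the
constant mean survive. -/
lemma integral_regularPart (d : ℂ) {q : ℂ} (hq : ∀ n : ℤ, q.im ≠ 2 * δ * n) :
    ∫ x in (-(L / 2))..(L / 2),
      regularPart (periods L δ hL hδ) (slope₁ L δ hL hδ) d ((x : ℂ) + q)
    = (periods L δ hL hδ).derivWeierstrassP d * lineIntegral L δ hL hδ q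
      + L * regularMean (periods L δ hL hδ) (slope₁ L δ hL hδ) d := by
  set P := periods L δ hL hδ
  set c := slope₁ L δ hL hδ
  have hd : ∀ x : ℝ, HasDerivAt (fun x : ℝ => regularPrimitive P c d ((x : ℂ) + q))
      (regularPart P c d (x + q) - ℘'[P] d * zetaLin P c (x + q) - regularMean P c d) x := by
    intro x
    have h1 := (hasDerivAt_regularPrimitive c d (real_add_notMem hL hδ hq x)).scomp x
      ((Complex.ofRealCLM.hasDerivAt (x := x)).add_const q)
    simpa using! h1
  have cR := continuous_regularPart_line hL hδ d hq
  have cZ := (continuous_zetaLin_line hL hδ hq).const_mul (℘'[P] d)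
  have cRZ : Continuous fun x : ℝ => regularPart P c d (x + q) - ℘'[P] d * zetaLin P c (x + q) :=
    cR.sub cZ
  have hint := intervalIntegral.integral_eq_sub_of_hasDerivAt (a := -(L / 2)) (b := L / 2)
    (fun x _ => hd x) ((cRZ.sub continuous_const).intervalIntegrable _ _)
  have hper : regularPrimitive P c d (((L / 2 : ℝ) : ℂ) + q)
      = regularPrimitive P c d (((-(L / 2) : ℝ) : ℂ) + q) := by
    have hz := real_add_notMem hL hδ hq (-(L / 2))
    have e : ((L / 2 : ℝ) : ℂ) + q = ((-(L / 2) : ℝ) : ℂ) + q + L := by push_cast; ring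
    rw [e]
    simp only [regularPrimitive]
    rw [zeta₁_add_L hL hδ hz, P.weierstrassP_add_coe _ ⟨L, L_mem_lattice hL hδ⟩,
      P.derivWeierstrassP_add_coe _ ⟨L, L_mem_lattice hL hδ⟩]
  rw [hper, sub_self, intervalIntegral.integral_sub (cRZ.intervalIntegrable _ _)
    (continuous_const.intervalIntegrable _ _), intervalIntegral.integral_sub
    (cR.intervalIntegrable _ _) (cZ.intervalIntegrable _ _), intervalIntegral.integral_const_mul,
    intervalIntegral.integral_const] at hint
  have e : ((L / 2 - -(L / 2) : ℝ)) = L := by ring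
  rw [e, Complex.real_smul] at hint
  rw [lineIntegral]
  linear_combination hint

end

/-! ### Action of T and T̃ on ℘' and the jump relation. -/

section

variable {L δ : ℝ} (hL : 0 < L) (hδ : 0 < δ)

/-- The kernel is separated with t = x' - p and d = p - x; the singular multiple of ζ₁(x' - x) has
principal value 0. -/
lemma hasT_derivWeierstrassP {p : ℂ} (hp : ∀ n : ℤ, (-p).im ≠ 2 * δ * n) (x : ℝ) :
    HasT L δ hL hδ (fun x' : ℝ => (periods L δ hL hδ).derivWeierstrassP (x' - p)) x
      (1 / (Real.pi : ℂ) *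
        ((periods L δ hL hδ).derivWeierstrassP (p - x) * lineIntegral L δ hL hδ (-p)
          + L * regularMean (periods L δ hL hδ) (slope₁ L δ hL hδ) (p - x))) := by
  rw [← integral_regularPart hL hδ (p - x) hp]
  refine hasT_of_decomposition hL hδ
    (A := -(periods L δ hL hδ).derivWeierstrassP (p - x))
    (continuous_regularPart_line hL hδ (p - x) hp) fun x' hx' => ?_
  have e : (x' : ℂ) + -p + (p - x) = x' - x := by ring
  have hd : p - x ∉ (periods L δ hL hδ).lattice := by
    have := neg_notMem (real_add_notMem hL hδ hp x)
    rwa [neg_add, neg_neg, neg_add_eq_sub] at this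
  have h := zetaLin_mul_derivWeierstrassP (slope₁ L δ hL hδ) (real_add_notMem hL hδ hp x') hd
    (by rwa [e])
  rwa [e, ← sub_eq_add_neg] at h

/-- The same separation with t = x' + iδ - p and the same d. The shifted kernel has no singularity
on the line, and its integral contributes where the principal value gave 0; the mean value term is
the one found for T. -/
lemma hasTtilde_derivWeierstrassP {p : ℂ} (hp : ∀ n : ℤ, (-p).im ≠ 2 * δ * n)
    (hp' : ∀ n : ℤ, (Complex.I * δ - p).im ≠ 2 * δ * n) (x : ℝ) :
    HasTtilde L δ hL hδ
      (fun x' : ℝ => (periods L δ hL hδ).derivWeierstrassP (x' + Complex.I * δ - p)) x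
      (1 / (Real.pi : ℂ) *
        (-(periods L δ hL hδ).derivWeierstrassP (p - x)
            * lineIntegral L δ hL hδ (Complex.I * δ)
          + (periods L δ hL hδ).derivWeierstrassP (p - x)
            * lineIntegral L δ hL hδ (Complex.I * δ - p)
          + L * regularMean (periods L δ hL hδ) (slope₁ L δ hL hδ) (p - x))) := by
  set P := periods L δ hL hδ
  set c := slope₁ L δ hL hδ
  have hI : ∀ n : ℤ, (Complex.I * (δ : ℂ)).im ≠ 2 * δ * n :=
    im_ne_of_pos (by simpa using hδ) (by simp; linarith)
  have hIx : ∀ n : ℤ, (Complex.I * (δ : ℂ) + (-x : ℝ)).im ≠ 2 * δ * n := by simpa using hI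
  have hd : p - x ∉ P.lattice := by
    have := neg_notMem (real_add_notMem hL hδ hp x)
    rwa [neg_add, neg_neg, neg_add_eq_sub] at this
  have heq : (fun x' : ℝ => zeta₁ P ((x' : ℂ) - x + Complex.I * δ)
      * ℘'[P] (x' + Complex.I * δ - p))
      = fun x' : ℝ => -℘'[P] (p - x) * zetaLin P c (x' + (Complex.I * δ + (-x : ℝ)))
        + regularPart P c (p - x) (x' + (Complex.I * δ - p)) := by
    ext x'
    have e : (x' : ℂ) + (Complex.I * δ - p) + (p - x) = x' + (Complex.I * δ + (-x : ℝ)) := by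
      push_cast; ring
    have h := zetaLin_mul_derivWeierstrassP c (real_add_notMem hL hδ hp' x') hd
      (by rw [e]; exact real_add_notMem hL hδ hIx x')
    rw [e] at h
    rw [← h, zeta₁_eq]
    congr 2
    · push_cast; ring
    · ring
  have c1 := (continuous_zetaLin_line hL hδ hIx).const_mul (-℘'[P] (p - x))
  have c2 := continuous_regularPart_line hL hδ (p - x) hp'
  refine ⟨?_, ?_⟩
  · rw [heq]
    exact (c1.add c2).intervalIntegrable _ _
  · have hJ : ∫ x' in (-(L / 2))..(L / 2), zetaLin P c ((x' : ℂ) + (Complex.I * δ + (-x : ℝ)))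
        = lineIntegral L δ hL hδ (Complex.I * δ) := lineIntegral_add_real hL hδ hI (-x)
    have hR : ∫ x' in (-(L / 2))..(L / 2), regularPart P c (p - x) (x' + (Complex.I * δ - p))
        = ℘'[P] (p - x) * lineIntegral L δ hL hδ (Complex.I * δ - p)
          + L * regularMean P c (p - x) := integral_regularPart hL hδ (p - x) hp'
    rw [heq, intervalIntegral.integral_add (c1.intervalIntegrable _ _)
      (c2.intervalIntegrable _ _), intervalIntegral.integral_const_mul, hR, hJ]
    ring

/-- The jump relation between the two integral operators, evaluated on a triple pole. The sign
depends on the strip in which the pole is located. -/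
lemma exists_hasT_hasTtilde {p : ℂ} {s : ℂ} (h : ∃ n : ℤ,
      (s = 1 ∧ 2 * δ * n - δ < p.im ∧ p.im < 2 * δ * n) ∨
      (s = -1 ∧ 2 * δ * n < p.im ∧ p.im < 2 * δ * n + δ)) (x : ℝ) :
    ∃ Y₁ Y₂ : ℂ,
      HasT L δ hL hδ (fun x' : ℝ => (periods L δ hL hδ).derivWeierstrassP (x' - p)) x Y₁ ∧
      HasTtilde L δ hL hδ
        (fun x' : ℝ => (periods L δ hL hδ).derivWeierstrassP (x' + Complex.I * δ - p)) x Y₂ ∧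
      Y₁ - Y₂ = Complex.I * s * (periods L δ hL hδ).derivWeierstrassP (x - p) := by
  obtain ⟨n, hn⟩ := h
  set P := periods L δ hL hδ
  -- Periodicity of ℘' moves the pole to the strip just below or just above the real axis, where the
  -- line integrals are known.
  set p₀ : ℂ := p - n * (2 * Complex.I * δ) with hp₀
  have hl : (n : ℂ) * (2 * Complex.I * δ) ∈ P.lattice :=
    (mem_lattice_periods hL hδ).mpr ⟨0, n, by simp⟩
  have him : p₀.im = p.im - 2 * δ * n := by simp [hp₀]; ring
  have hP : ∀ z : ℂ, ℘'[P] (z - p) = ℘'[P] (z - p₀) := fun z => by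
    have := P.derivWeierstrassP_add_coe (z - p) ⟨_, hl⟩
    rw [← this, hp₀]
    congr 1
    simp only
    ring
  simp only [hP]
  have hpi : (Real.pi : ℂ) ≠ 0 := by exact_mod_cast Real.pi_ne_zero
  have hI : lineIntegral L δ hL hδ (Complex.I * δ) = -(Real.pi * Complex.I) :=
    lineIntegral_of_im_pos hL hδ (by simpa using hδ) (by simp; linarith)
  have hodd : ℘'[P] (p₀ - x) = -℘'[P] (x - p₀) := by rw [← P.derivWeierstrassP_neg, neg_sub]
  -- In the lower strip -p₀ and iδ - p₀ both lie above the real axis and their line integrals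
  -- cancel. In the upper strip -p₀ lies below the axis, which reverses the sign of its integral and
  -- hence that of the result. The mean values cancel in both cases.
  rcases hn with ⟨hs, h1, h2⟩ | ⟨hs, h1, h2⟩
  · have hp : ∀ k : ℤ, (-p₀).im ≠ 2 * δ * k :=
      im_ne_of_pos (by simp; linarith) (by simp; linarith)
    have hp' : ∀ k : ℤ, (Complex.I * δ - p₀).im ≠ 2 * δ * k :=
      im_ne_of_pos (by simp; linarith) (by simp; linarith)
    refine ⟨_, _, hasT_derivWeierstrassP hL hδ hp x, hasTtilde_derivWeierstrassP hL hδ hp hp' x, ?_⟩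
    rw [hI, lineIntegral_of_im_pos hL hδ (q := -p₀) (by simp; linarith) (by simp; linarith),
      lineIntegral_of_im_pos hL hδ (q := Complex.I * δ - p₀) (by simp; linarith)
      (by simp; linarith), hodd, hs]
    field_simp
    ring
  · have hp : ∀ k : ℤ, (-p₀).im ≠ 2 * δ * k := by
      intro k hk
      refine im_ne_of_pos (q := p₀) (δ := δ) (by linarith) (by linarith) (-k) ?_
      rw [Complex.neg_im] at hk
      push_cast
      linarith
    have hp' : ∀ k : ℤ, (Complex.I * δ - p₀).im ≠ 2 * δ * k :=
      im_ne_of_pos (by simp; linarith) (by simp; linarith)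
    refine ⟨_, _, hasT_derivWeierstrassP hL hδ hp x, hasTtilde_derivWeierstrassP hL hδ hp hp' x, ?_⟩
    rw [hI, lineIntegral_of_im_neg hL hδ (q := -p₀) (by simp; linarith) (by simp; linarith),
      lineIntegral_of_im_pos hL hδ (q := Complex.I * δ - p₀) (by simp; linarith)
      (by simp; linarith), hodd, hs]
    field_simp
    ring

lemma HasT.sum {ι : Type*} [Fintype ι] {f : ι → ℝ → ℂ} {x : ℝ} {Y : ι → ℂ} (a : ι → ℂ)
    (h : ∀ m, HasT L δ hL hδ (f m) x (Y m)) :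
    HasT L δ hL hδ (fun x' => ∑ m, a m * f m x') x (∑ m, a m * Y m) := by
  have e : ∀ x' : ℝ, zeta₁ (periods L δ hL hδ) ((x' : ℂ) - x) * ∑ m, a m * f m x'
      = ∑ m, a m * (zeta₁ (periods L δ hL hδ) ((x' : ℂ) - x) * f m x') := fun x' => by
    rw [Finset.mul_sum]
    exact Finset.sum_congr rfl fun m _ => by ring
  refine ⟨fun ε hε => ?_, ?_⟩
  · simp only [e]
    exact integrable_finsetSum _ fun m _ => ((h m).1 ε hε).const_mul (a m)
  · refine (tendsto_finsetSum _ fun m _ => ((h m).2.const_mul (a m))).congr' ?_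
    filter_upwards [self_mem_nhdsWithin] with ε hε
    simp only [e]
    rw [integral_finsetSum _ fun m _ => ((h m).1 ε hε).const_mul (a m), Finset.mul_sum]
    refine Finset.sum_congr rfl fun m _ => ?_
    rw [integral_const_mul]
    ring

lemma HasTtilde.sum {ι : Type*} [Fintype ι] {f : ι → ℝ → ℂ} {x : ℝ} {Y : ι → ℂ} (a : ι → ℂ)
    (h : ∀ m, HasTtilde L δ hL hδ (f m) x (Y m)) :
    HasTtilde L δ hL hδ (fun x' => ∑ m, a m * f m x') x (∑ m, a m * Y m) := by
  have e : ∀ x' : ℝ, zeta₁ (periods L δ hL hδ) ((x' : ℂ) - x + Complex.I * δ)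
        * ∑ m, a m * f m x'
      = ∑ m, a m * (zeta₁ (periods L δ hL hδ) ((x' : ℂ) - x + Complex.I * δ) * f m x') :=
    fun x' => by
      rw [Finset.mul_sum]
      exact Finset.sum_congr rfl fun m _ => by ring
  have hi := fun m => (h m).1.const_mul (a m)
  refine ⟨?_, ?_⟩
  · simp only [e]
    have := IntervalIntegrable.sum Finset.univ fun m _ => hi m
    convert! this using 1
    ext x'
    simp
  · simp only [e]
    rw [intervalIntegral.integral_finsetSum fun m _ => hi m, Finset.mul_sum]
    refine Finset.sum_congr rfl fun m _ => ?_
    rw [intervalIntegral.integral_const_mul, ← (h m).2]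
    ring

end

/-! ### From charged poles to solutions of the equation. -/

section

section field

variable {P : PeriodPair} {ι : Type*} [Fintype ι]

variable (P) in
/-- A sum of `ζ`-functions with moving poles. -/
def poleField (c : ℂ) (r : ι → ℂ) (p : ι → ℝ → ℂ) (σ : ℂ) (x t : ℝ) : ℂ :=
  ∑ m, r m * zetaLin P c ((x : ℂ) + σ - p m t)

lemma hasDerivAt_poleField_space (c : ℂ) (r : ι → ℂ) (p : ι → ℝ → ℂ) {σ : ℂ} {x t : ℝ}
    (h : ∀ m, (x : ℂ) + σ - p m t ∉ P.lattice) :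
    HasDerivAt (fun y => poleField P c r p σ y t)
      (∑ m, r m * zetaLinDeriv P c ((x : ℂ) + σ - p m t)) x := by
  refine HasDerivAt.fun_sum fun m _ => HasDerivAt.const_mul _ ?_
  have := (hasDerivAt_zetaLin c (h m)).scomp x
    (((Complex.ofRealCLM.hasDerivAt (x := x)).add_const σ).sub_const (p m t))
  simpa using! this

lemma iteratedDeriv_two_poleField (c : ℂ) (r : ι → ℂ) (p : ι → ℝ → ℂ) {σ : ℂ} {t : ℝ}
    (h : ∀ m, ∀ x : ℝ, (x : ℂ) + σ - p m t ∉ P.lattice) :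
    iteratedDeriv 2 (fun y => poleField P c r p σ y t)
      = fun x : ℝ => ∑ m, -r m * ℘'[P] ((x : ℂ) + σ - p m t) := by
  have h1 : deriv (fun y => poleField P c r p σ y t)
      = fun x : ℝ => ∑ m, r m * zetaLinDeriv P c ((x : ℂ) + σ - p m t) :=
    funext fun x => (hasDerivAt_poleField_space c r p fun m => h m x).deriv
  rw [iteratedDeriv_succ, iteratedDeriv_one, h1]
  ext x
  refine HasDerivAt.deriv (HasDerivAt.fun_sum fun m _ => ?_)
  have h2 := (hasDerivAt_zetaLinDeriv c (h m x)).scomp x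
    (((Complex.ofRealCLM.hasDerivAt (x := x)).add_const σ).sub_const (p m t))
  have h3 : HasDerivAt (fun x : ℝ => zetaLinDeriv P c ((x : ℂ) + σ - p m t))
      (-℘'[P] ((x : ℂ) + σ - p m t)) x := by simpa using! h2
  convert! h3.const_mul (r m) using 1
  ring

lemma hasDerivAt_poleField_time (c : ℂ) (r : ι → ℂ) (p : ι → ℝ → ℂ) {σ : ℂ} {x t : ℝ}
    (h : ∀ m, (x : ℂ) + σ - p m t ∉ P.lattice) {p' : ι → ℂ}
    (hp : ∀ m, HasDerivAt (p m) (p' m) t) :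
    HasDerivAt (fun s => poleField P c r p σ x s)
      (∑ m, r m * (zetaLinDeriv P c ((x : ℂ) + σ - p m t) * -p' m)) t := by
  refine HasDerivAt.fun_sum fun m _ => HasDerivAt.const_mul _ ?_
  exact (hasDerivAt_zetaLin c (h m)).comp t ((hp m).const_sub ((x : ℂ) + σ))

lemma contDiffOn_poleField (c : ℂ) (r : ι → ℂ) (p : ι → ℝ → ℂ) {σ : ℂ} {I : Set ℝ}
    (hI : IsOpen I) (h : ∀ t ∈ I, ∀ m, ∀ x : ℝ, (x : ℂ) + σ - p m t ∉ P.lattice)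
    (hp : ∀ m, ContDiffOn ℝ 2 (p m) I) :
    ContDiffOn ℝ 2 (fun y : ℝ × ℝ => poleField P c r p σ y.1 y.2) (Set.univ ×ˢ I) := by
  refine ContDiffOn.sum fun m _ => contDiffOn_const.mul ?_
  rintro ⟨x, t⟩ ⟨-, ht⟩
  have hd : DifferentiableOn ℂ (zetaLin P c) (P.lattice : Set ℂ)ᶜ := fun z hz =>
    (hasDerivAt_zetaLin c hz).differentiableAt.differentiableWithinAt
  have h1 : ContDiffAt ℝ 2 (zetaLin P c) ((x : ℂ) + σ - p m t) :=
    ((hd.analyticAt (P.isClosed_lattice.isOpen_compl.mem_nhds (h t ht m x))).contDiffAt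
      (n := 2)).restrict_scalars ℝ
  have h2 : ContDiffAt ℝ 2 (fun y : ℝ × ℝ => p m y.2) (x, t) :=
    ((hp m).contDiffAt (hI.mem_nhds ht)).comp (x, t) contDiffAt_snd
  have h3 : ContDiffAt ℝ 2 (fun y : ℝ × ℝ => (y.1 : ℂ)) (x, t) :=
    Complex.ofRealCLM.contDiff.contDiffAt.comp (x, t) contDiffAt_fst
  exact (ContDiffAt.comp (x, t) (g := zetaLin P c)
    (f := fun y : ℝ × ℝ => (y.1 : ℂ) + σ - p m y.2) h1
    ((h3.add contDiffAt_const).sub h2)).contDiffWithinAt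

end field

variable {L δ : ℝ} (hL : 0 < L) (hδ : 0 < δ)

lemma exists_zeta₂_add_L : ∃ κ : ℂ, ∀ z ∉ (periods L δ hL hδ).lattice,
    zetaLin (periods L δ hL hδ) (slope₂ L δ hL hδ) (z + L)
      = zetaLin (periods L δ hL hδ) (slope₂ L δ hL hδ) z + κ := by
  obtain ⟨η, hη⟩ := exists_zeta_add_period (L_mem_lattice hL hδ)
  refine ⟨η - slope₂ L δ hL hδ * L, fun z hz => ?_⟩
  simp only [zetaLin, hη z hz]
  ring

variable {ι : Type*} [Fintype ι]

/-- Each ζ₂ acquires the same constant κ under translation by L, and neutrality annihilates the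
total. -/
lemma poleField_add_L (r : ι → ℂ) (hr : ∑ m, r m = 0) (p : ι → ℝ → ℂ) {σ : ℂ} {t x : ℝ}
    (h : ∀ m, (x : ℂ) + σ - p m t ∉ (periods L δ hL hδ).lattice) :
    poleField (periods L δ hL hδ) (slope₂ L δ hL hδ) r p σ (x + L) t
      = poleField (periods L δ hL hδ) (slope₂ L δ hL hδ) r p σ x t := by
  obtain ⟨κ, hκ⟩ := exists_zeta₂_add_L hL hδ
  have e : ∀ m, r m * zetaLin (periods L δ hL hδ) (slope₂ L δ hL hδ)
      (((x + L : ℝ) : ℂ) + σ - p m t)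
      = r m * zetaLin (periods L δ hL hδ) (slope₂ L δ hL hδ) ((x : ℂ) + σ - p m t)
        + r m * κ := fun m => by
    rw [← mul_add, ← hκ _ (h m)]
    congr 2
    push_cast
    ring
  simp only [poleField, e, Finset.sum_add_distrib, ← Finset.sum_mul, hr, zero_mul, add_zero]

/-- Poles which move according to the first-order dynamics give a solution, if the poles of
charge `1` and `-1` stay in the appropriate strips. -/
theorem isPeriodicSolution_of_poles [DecidableEq ι] (r : ι → ℂ) (hr : ∑ m, r m = 0) (p : ι → ℝ → ℂ) {I : Set ℝ}
    (hI : IsOpen I) (hp : ∀ m, ContDiffOn ℝ 2 (p m) I)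
    (hpp : ∀ t ∈ I, ∀ m l, m ≠ l → p m t - p l t ∉ (periods L δ hL hδ).lattice)
    (hstrip : ∀ t ∈ I, ∀ m, ∃ n : ℤ,
      (r m = 1 ∧ 2 * δ * n + δ < (p m t).im ∧ (p m t).im < 2 * δ * n + 2 * δ) ∨
      (r m = -1 ∧ 2 * δ * n < (p m t).im ∧ (p m t).im < 2 * δ * n + δ))
    (hdyn : ∀ t ∈ I, ∀ j, deriv (p j) t
      = poleVelocity (periods L δ hL hδ) (slope₂ L δ hL hδ) r (fun m => p m t) j)
    {u v : ℝ → ℝ → ℂ}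
    (hu : ∀ t ∈ I, ∀ x, u x t
      = Complex.I * poleField (periods L δ hL hδ) (slope₂ L δ hL hδ) r p 0 x t)
    (hv : ∀ t ∈ I, ∀ x, v x t = -(Complex.I *
      poleField (periods L δ hL hδ) (slope₂ L δ hL hδ) r p (Complex.I * δ) x t)) :
    IsPeriodicSolution L δ hL hδ I u v := by
  set P := periods L δ hL hδ
  set c := slope₂ L δ hL hδ
  have hreal : ∀ {x : ℝ} {σ z : ℂ}, ((x : ℂ) + σ - z).im = σ.im - z.im := by simp
  have hns : ∀ σ : ℂ, σ = 0 ∨ σ = Complex.I * δ → ∀ t ∈ I, ∀ m, ∀ x : ℝ,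
      (x : ℂ) + σ - p m t ∉ P.lattice := by
    rintro σ hσ t ht m x
    obtain ⟨n, hn⟩ := hstrip t ht m
    have h0 : (0 : ℂ).im = 0 := rfl
    have hIδ : (Complex.I * (δ : ℂ)).im = δ := by simp
    have key : ∃ k : ℤ, 2 * δ * k < σ.im - (p m t).im ∧ σ.im - (p m t).im < 2 * δ * (k + 1) := by
      rcases hσ with rfl | rfl
      · refine ⟨-n - 1, ?_⟩
        rw [h0]
        push_cast
        rcases hn with ⟨-, h1, h2⟩ | ⟨-, h1, h2⟩ <;> constructor <;> nlinarith
      · rw [hIδ]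
        rcases hn with ⟨-, h1, h2⟩ | ⟨-, h1, h2⟩
        · refine ⟨-n - 1, ?_⟩
          push_cast
          constructor <;> nlinarith
        · refine ⟨-n, ?_⟩
          push_cast
          constructor <;> nlinarith
    obtain ⟨k, hk1, hk2⟩ := key
    exact notMem_lattice_of_im hL hδ k (by rwa [hreal]) (by rwa [hreal])
  have hn0 := hns 0 (Or.inl rfl)
  have hnI := hns _ (Or.inr rfl)
  have hr2 : ∀ t ∈ I, ∀ m, r m ^ 2 = 1 := fun t ht m => by
    obtain ⟨n, ⟨h, -⟩ | ⟨h, -⟩⟩ := hstrip t ht m <;> rw [h] <;> norm_num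
  have hpd : ∀ t ∈ I, ∀ m, HasDerivAt (p m) (poleVelocity P c r (fun m => p m t) m) t := by
    intro t ht m
    rw [← hdyn t ht m]
    exact (((hp m).contDiffAt (hI.mem_nhds ht)).differentiableAt (by norm_num)).hasDerivAt
  -- One identity serves both equations. Since v = -U with σ = iδ, v_t - 2 v v_x = -(U_t + 2 U U_x).
  have heq : ∀ σ : ℂ, σ = 0 ∨ σ = Complex.I * δ → ∀ t ∈ I, ∀ x : ℝ,
      Complex.I * deriv (fun s => poleField P c r p σ x s) t
        + 2 * (Complex.I * poleField P c r p σ x t)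
          * (Complex.I * deriv (fun y => poleField P c r p σ y t) x)
      = -∑ m, ℘'[P] ((x : ℂ) + σ - p m t) := by
    intro σ hσ t ht x
    have hn := fun m => hns σ hσ t ht m x
    rw [(hasDerivAt_poleField_time c r p hn (hpd t ht)).deriv,
      (hasDerivAt_poleField_space c r p hn).deriv]
    exact pole_ansatz_identity c r (fun m => p m t) hr (hr2 t ht) (hpp t ht) _ hn
  refine ⟨?_, ?_, ?_, ?_, ?_⟩
  · exact (contDiffOn_const.mul (contDiffOn_poleField c r p hI hn0 hp)).congr
      fun y hy => hu y.2 hy.2 y.1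
  · exact (contDiffOn_const.mul (contDiffOn_poleField c r p hI hnI hp)).neg.congr
      fun y hy => hv y.2 hy.2 y.1
  · intro t ht x
    rw [hu t ht, hu t ht, poleField_add_L hL hδ r hr p fun m => hn0 t ht m x]
  · intro t ht x
    rw [hv t ht, hv t ht, poleField_add_L hL hδ r hr p fun m => hnI t ht m x]
  · intro t ht x
    have hufun : (fun y => u y t) = fun y => Complex.I * poleField P c r p 0 y t :=
      funext fun y => hu t ht y
    have hvfun : (fun y => v y t)
        = fun y => -Complex.I * poleField P c r p (Complex.I * δ) y t :=
      funext fun y => by rw [hv t ht y]; ring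
    have huxx : iteratedDeriv 2 (fun y => u y t)
        = fun y : ℝ => ∑ m, (-(Complex.I * r m)) * ℘'[P] (y - p m t) := by
      ext y
      rw [hufun, iteratedDeriv_const_mul_field, iteratedDeriv_two_poleField c r p (hn0 t ht),
        Finset.mul_sum]
      exact Finset.sum_congr rfl fun m _ => by rw [add_zero]; ring
    have hvxx : iteratedDeriv 2 (fun y => v y t)
        = fun y : ℝ => ∑ m, (Complex.I * r m) * ℘'[P] (y + Complex.I * δ - p m t) := by
      ext y
      rw [hvfun, iteratedDeriv_const_mul_field, iteratedDeriv_two_poleField c r p (hnI t ht),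
        Finset.mul_sum]
      exact Finset.sum_congr rfl fun m _ => by ring
    have hper : ∀ y : ℝ, ∀ m, ℘'[P] (y - p m t)
        = ℘'[P] (y + Complex.I * δ - (p m t - Complex.I * δ)) := fun y m => by
      rw [← P.derivWeierstrassP_add_coe _ ⟨_, two_I_delta_mem_lattice hL hδ⟩]
      congr 1
      simp only
      ring
    have hper' : ∀ y : ℝ, ∀ m, ℘'[P] (y + Complex.I * δ - p m t)
        = ℘'[P] (y - (p m t - Complex.I * δ)) := fun y m => by
      congr 1
      ring
    have hJ1 : ∀ m, ∃ Y₁ Y₂ : ℂ, HasT L δ hL hδ (fun y : ℝ => ℘'[P] (y - p m t)) x Y₁ ∧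
        HasTtilde L δ hL hδ (fun y : ℝ => ℘'[P] (y + Complex.I * δ - p m t)) x Y₂ ∧
        Y₁ - Y₂ = Complex.I * r m * ℘'[P] (x - p m t) := fun m => by
      obtain ⟨n, hn⟩ := hstrip t ht m
      rcases hn with ⟨h, h1, h2⟩ | ⟨h, h1, h2⟩
      -- A pole of charge 1 lies in the upper half of its row, that is, just below the next row of
      -- the lattice; hence n + 1.
      · refine exists_hasT_hasTtilde hL hδ ⟨n + 1, Or.inl ⟨h, ?_, ?_⟩⟩ x <;> push_cast <;> linarith
      · exact exists_hasT_hasTtilde hL hδ ⟨n, Or.inr ⟨h, h1, h2⟩⟩ x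
    -- Here T̃ acts on the unshifted function. By the period 2iδ this is the jump relation for the
    -- pole p - iδ, which lies in a strip of the opposite kind, so the charge enters with a minus
    -- sign.
    have hJ2 : ∀ m, ∃ Y₁ Y₂ : ℂ,
        HasT L δ hL hδ (fun y : ℝ => ℘'[P] (y + Complex.I * δ - p m t)) x Y₁ ∧
        HasTtilde L δ hL hδ (fun y : ℝ => ℘'[P] (y - p m t)) x Y₂ ∧
        Y₁ - Y₂ = -(Complex.I * r m) * ℘'[P] (x + Complex.I * δ - p m t) := fun m => by
      obtain ⟨n, hn⟩ := hstrip t ht m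
      simp only [hper, hper', neg_mul_eq_mul_neg]
      have him : (p m t - Complex.I * δ).im = (p m t).im - δ := by simp
      refine exists_hasT_hasTtilde hL hδ ⟨n, ?_⟩ x
      rw [him]
      rcases hn with ⟨h, h1, h2⟩ | ⟨h, h1, h2⟩
      · exact Or.inr ⟨by rw [h], by linarith, by linarith⟩
      · exact Or.inl ⟨by rw [h, neg_neg], by linarith, by linarith⟩
    choose A₁ A₂ hA₁ hA₂ hA using hJ1
    choose B₁ B₂ hB₁ hB₂ hB using hJ2
    have hut : deriv (fun s => u x s) t
        = Complex.I * deriv (fun s => poleField P c r p 0 x s) t := by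
      have : (fun s => u x s) =ᶠ[𝓝 t] fun s => Complex.I * poleField P c r p 0 x s := by
        filter_upwards [hI.mem_nhds ht] with s hs using hu s hs x
      rw [this.deriv_eq, deriv_const_mul_field]
    have hvt : deriv (fun s => v x s) t
        = -Complex.I * deriv (fun s => poleField P c r p (Complex.I * δ) x s) t := by
      have : (fun s => v x s) =ᶠ[𝓝 t]
          fun s => -Complex.I * poleField P c r p (Complex.I * δ) x s := by
        filter_upwards [hI.mem_nhds ht] with s hs
        rw [hv s hs x]
        ring
      rw [this.deriv_eq, deriv_const_mul_field]
    have hsum1 : ∑ m, -(Complex.I * r m) * A₁ m + ∑ m, (Complex.I * r m) * A₂ m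
        = ∑ m, ℘'[P] ((x : ℂ) + 0 - p m t) := by
      rw [← Finset.sum_add_distrib]
      refine Finset.sum_congr rfl fun m _ => ?_
      rw [add_zero]
      linear_combination -(Complex.I * r m) * hA m
        - r m ^ 2 * ℘'[P] (x - p m t) * Complex.I_sq + ℘'[P] (x - p m t) * hr2 t ht m
    have hsum2 : ∑ m, (Complex.I * r m) * B₁ m + ∑ m, -(Complex.I * r m) * B₂ m
        = ∑ m, ℘'[P] ((x : ℂ) + Complex.I * δ - p m t) := by
      rw [← Finset.sum_add_distrib]
      refine Finset.sum_congr rfl fun m _ => ?_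
      linear_combination (Complex.I * r m) * hB m
        - r m ^ 2 * ℘'[P] (x + Complex.I * δ - p m t) * Complex.I_sq
        + ℘'[P] (x + Complex.I * δ - p m t) * hr2 t ht m
    refine ⟨∑ m, -(Complex.I * r m) * A₁ m, ∑ m, (Complex.I * r m) * B₁ m,
      ∑ m, -(Complex.I * r m) * B₂ m, ∑ m, (Complex.I * r m) * A₂ m, ?_, ?_, ?_, ?_, ?_, ?_⟩
    · rw [huxx]; exact HasT.sum hL hδ _ hA₁
    · rw [hvxx]; exact HasT.sum hL hδ _ hB₁
    · rw [huxx]; exact HasTtilde.sum hL hδ _ hB₂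
    · rw [hvxx]; exact HasTtilde.sum hL hδ _ hA₂
    · rw [hut, hufun, deriv_const_mul_field, hu t ht x]
      linear_combination heq 0 (Or.inl rfl) t ht x + hsum1
    · rw [hvt, hvfun, deriv_const_mul_field, hv t ht x]
      linear_combination -heq _ (Or.inr rfl) t ht x - hsum2

end

/-! ### Regularity and confinement of Calogero–Moser trajectories; charges. -/

section

variable {L δ : ℝ} {hL : 0 < L} {hδ : 0 < δ} {I : Set ℝ} {N : ℕ} {z : Fin N → ℝ → ℂ}

/-- The equation itself expresses the second derivative as a continuous function of positions that
do not collide. -/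
lemma IsCalogeroMoser.contDiffOn (hz : IsCalogeroMoser L δ hL hδ I z) (hI : IsOpen I)
    (j : Fin N) : ContDiffOn ℝ 2 (z j) I := by
  have hc : ∀ t ∈ I, ∀ j, ContinuousAt (z j) t := fun t ht j =>
    (hz.differentiableAt t ht j).continuousAt
  rw [show (2 : WithTop ℕ∞) = 1 + 1 by norm_num, contDiffOn_succ_iff_deriv_of_isOpen hI]
  refine ⟨fun t ht => (hz.differentiableAt t ht j).differentiableWithinAt, by simp, ?_⟩
  rw [show (1 : WithTop ℕ∞) = 0 + 1 by norm_num, contDiffOn_succ_iff_deriv_of_isOpen hI]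
  refine ⟨fun t ht => (hz.equation t ht j).differentiableAt.differentiableWithinAt, by simp, ?_⟩
  rw [contDiffOn_zero]
  have hcont : ContinuousOn (fun t => -4 * ∑ k ∈ Finset.univ.erase j,
      (periods L δ hL hδ).derivWeierstrassP (z j t - z k t)) I := by
    refine continuousOn_const.mul (continuousOn_finsetSum _ fun k hk t ht => ?_)
    exact (ContinuousAt.comp_of_eq (f := fun t => z j t - z k t)
      (hasDerivAt_derivWeierstrassP
        (hz.noncollision t ht j k (Finset.ne_of_mem_erase hk).symm)).continuousAt
      ((hc t ht j).sub (hc t ht k)) rfl).continuousWithinAt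
  exact hcont.congr fun t ht => (hz.equation t ht j).deriv

/-- The poles remain in the strips in which they start. -/
lemma IsCalogeroMoser.exists_strip (hz : IsCalogeroMoser L δ hL hδ I z) (hI : I.OrdConnected)
    {t₀ : ℝ} (ht₀ : t₀ ∈ I) {j : Fin N} (h0 : ∀ n : ℤ, δ / 2 < |(z j t₀).im - 2 * δ * n|) :
    ∃ n : ℤ, ∀ t ∈ I, 2 * δ * n + δ / 2 < (z j t).im ∧ (z j t).im < 2 * δ * n + 3 * δ / 2 := by
  set n : ℤ := ⌊(z j t₀).im / (2 * δ)⌋ with hn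
  have hδ2 : 0 < 2 * δ := by linarith
  have hn1 : 2 * δ * n ≤ (z j t₀).im := by
    have := Int.floor_le ((z j t₀).im / (2 * δ))
    rw [le_div_iff₀ hδ2] at this
    rw [hn]
    linarith
  have hn2 : (z j t₀).im < 2 * δ * n + 2 * δ := by
    have := Int.lt_floor_add_one ((z j t₀).im / (2 * δ))
    rw [div_lt_iff₀ hδ2] at this
    rw [hn]
    linarith
  have hlow : 2 * δ * n + δ / 2 < (z j t₀).im := by
    have := h0 n
    rw [abs_of_nonneg (by linarith)] at this
    linarith
  have hup : (z j t₀).im < 2 * δ * n + 3 * δ / 2 := by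
    have := h0 (n + 1)
    push_cast at this
    rw [abs_of_nonpos (by linarith)] at this
    linarith
  -- Intermediate values: leaving the strip would force Im z = 2δn + δ/2 or Im z = 2δ(n + 1) - δ/2
  -- at some time, and both are excluded by `im_ne`.
  have himg : ((fun t => (z j t).im) '' I).OrdConnected := by
    refine (hI.isPreconnected.image _ fun t ht => ?_).ordConnected
    exact (Complex.continuous_im.continuousAt.comp
      (hz.differentiableAt t ht j).continuousAt).continuousWithinAt
  have hmem : ∀ t ∈ I, (z j t).im ∈ (fun t => (z j t).im) '' I := fun t ht => ⟨t, ht, rfl⟩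
  refine ⟨n, fun t ht => ⟨?_, ?_⟩⟩
  · by_contra hcon
    obtain ⟨s, hs, hs'⟩ := himg.out (hmem t ht) (hmem t₀ ht₀) ⟨not_lt.mp hcon, hlow.le⟩
    refine (hz.im_ne s hs j n).2 ?_
    simp only at hs'
    simp [hs']
  · by_contra hcon
    obtain ⟨s, hs, hs'⟩ := himg.out (hmem t₀ ht₀) (hmem t ht) ⟨hup.le, not_lt.mp hcon⟩
    refine (hz.im_ne s hs j (n + 1)).1 ?_
    simp only at hs'
    simp [hs']
    ring

lemma sum_erase_inl {N M : ℕ} (f : Fin N ⊕ Fin M → ℂ) (j : Fin N) :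
    ∑ m ∈ Finset.univ.erase (Sum.inl j), f m
      = ∑ k ∈ Finset.univ.erase j, f (Sum.inl k) + ∑ k, f (Sum.inr k) := by
  rw [← Finset.sum_disjSum]
  congr 1
  ext m
  rcases m with m | m <;> simp

lemma sum_erase_inr {N M : ℕ} (f : Fin N ⊕ Fin M → ℂ) (j : Fin M) :
    ∑ m ∈ Finset.univ.erase (Sum.inr j), f m
      = ∑ k, f (Sum.inl k) + ∑ k ∈ Finset.univ.erase j, f (Sum.inr k) := by
  rw [← Finset.sum_disjSum]
  congr 1
  ext m
  rcases m with m | m <;> simp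

variable (N) in
/-- The charges of the poles. -/
def charge : Fin N ⊕ Fin N → ℂ := Sum.elim (fun _ => 1) (fun _ => -1)

variable (δ) in
/-- The positions of the poles of the soliton solution. -/
def solitonPole (z w : Fin N → ℝ → ℂ) (m : Fin N ⊕ Fin N) (t : ℝ) : ℂ :=
  Sum.elim (fun j => z j t + Complex.I * δ / 2) (fun j => w j t - Complex.I * δ / 2) m

lemma sum_charge : ∑ m, charge N m = 0 := by
  simp [charge, Fintype.sum_sum_type]

lemma charge_sq (m : Fin N ⊕ Fin N) : charge N m ^ 2 = 1 := by
  rcases m with m | m <;> simp [charge]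

end

end NcILW

end

/-! ### The main theorem. -/

open NcILW in
theorem mainTheorem3 (L δ : ℝ) (hL : 0 < L) (hδ : 0 < δ) (N : ℕ) (a b : Fin N → ℂ)
    (ha : ∀ j, ∀ n : ℤ, δ / 2 < |(a j).im - 2 * δ * n|)
    (hb : ∀ j, ∀ n : ℤ, δ / 2 < |(b j).im - 2 * δ * n|)
    (I : Set ℝ) (hI : IsOpen I) (hI' : I.OrdConnected) (h0 : (0 : ℝ) ∈ I)
    (z w : Fin N → ℝ → ℂ)
    (hz : NcILW.IsCalogeroMoser L δ hL hδ I z)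
    (hw : NcILW.IsCalogeroMoser L δ hL hδ I w)
    (hz0 : ∀ j, z j 0 = a j)
    (hw0 : ∀ j, w j 0 = b j)
    (hz1 : ∀ j, deriv (z j) 0 =
      2 * Complex.I * ∑ k ∈ Finset.univ.erase j,
          NcILW.zeta₂ (NcILW.periods L δ hL hδ) (a j - a k)
        - 2 * Complex.I * ∑ k,
          NcILW.zeta₂ (NcILW.periods L δ hL hδ) (a j - b k + Complex.I * (δ : ℂ)))
    (hw1 : ∀ j, deriv (w j) 0 =
      -2 * Complex.I * ∑ k ∈ Finset.univ.erase j,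
          NcILW.zeta₂ (NcILW.periods L δ hL hδ) (b j - b k)
        + 2 * Complex.I * ∑ k,
          NcILW.zeta₂ (NcILW.periods L δ hL hδ) (b j - a k + Complex.I * (δ : ℂ))) :
    NcILW.IsPeriodicSolution L δ hL hδ I
      (NcILW.solitonU L δ hL hδ z w) (NcILW.solitonV L δ hL hδ z w) := by
  have hzs : ∀ j, ∃ n : ℤ, ∀ t ∈ I,
      2 * δ * n + δ / 2 < (z j t).im ∧ (z j t).im < 2 * δ * n + 3 * δ / 2 := fun j =>
    hz.exists_strip hI' h0 (by rw [hz0]; exact ha j)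
  have hws : ∀ j, ∃ n : ℤ, ∀ t ∈ I,
      2 * δ * n + δ / 2 < (w j t).im ∧ (w j t).im < 2 * δ * n + 3 * δ / 2 := fun j =>
    hw.exists_strip hI' h0 (by rw [hw0]; exact hb j)
  -- Both imaginary parts lie in open strips of width δ, so their difference is within δ of 2δ(n -
  -- n'); after adding δ it falls strictly between two rows of the lattice.
  have hcross : ∀ t ∈ I, ∀ j k,
      z j t - w k t + Complex.I * δ ∉ (periods L δ hL hδ).lattice := by
    intro t ht j k
    obtain ⟨n, hn⟩ := hzs j
    obtain ⟨n', hn'⟩ := hws k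
    obtain ⟨h1, h2⟩ := hn t ht
    obtain ⟨h3, h4⟩ := hn' t ht
    have him : (z j t - w k t + Complex.I * δ).im = (z j t).im - (w k t).im + δ := by simp
    refine notMem_lattice_of_im hL hδ (n - n') ?_ ?_ <;> rw [him] <;> push_cast <;> linarith
  have hcross' : ∀ t ∈ I, ∀ j k,
      w j t - z k t - Complex.I * δ ∉ (periods L δ hL hδ).lattice := by
    intro t ht j k
    have := neg_notMem (hcross t ht k j)
    rwa [show -(z k t - w j t + Complex.I * δ) = w j t - z k t - Complex.I * δ by ring] at this
  set p := solitonPole δ z w with hp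
  have ezz : ∀ t j k, p (Sum.inl j) t - p (Sum.inl k) t = z j t - z k t := fun t j k => by
    simp [hp, solitonPole]
  have eww : ∀ t j k, p (Sum.inr j) t - p (Sum.inr k) t = w j t - w k t := fun t j k => by
    simp [hp, solitonPole]
  have ezw : ∀ t j k, p (Sum.inl j) t - p (Sum.inr k) t = z j t - w k t + Complex.I * δ :=
    fun t j k => by simp only [hp, solitonPole, Sum.elim_inl, Sum.elim_inr]; ring
  have ewz : ∀ t j k, p (Sum.inr j) t - p (Sum.inl k) t = w j t - z k t - Complex.I * δ :=
    fun t j k => by simp only [hp, solitonPole, Sum.elim_inl, Sum.elim_inr]; ring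
  have hpp : ∀ t ∈ I, ∀ m l, m ≠ l → p m t - p l t ∉ (periods L δ hL hδ).lattice := by
    rintro t ht (j | j) (k | k) hjk
    · rw [ezz]; exact hz.noncollision t ht j k fun h => hjk (by rw [h])
    · rw [ezw]; exact hcross t ht j k
    · rw [ewz]; exact hcross' t ht j k
    · rw [eww]; exact hw.noncollision t ht j k fun h => hjk (by rw [h])
  have hstrip : ∀ t ∈ I, ∀ m, ∃ n : ℤ,
      (charge N m = 1 ∧ 2 * δ * n + δ < (p m t).im ∧ (p m t).im < 2 * δ * n + 2 * δ) ∨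
      (charge N m = -1 ∧ 2 * δ * n < (p m t).im ∧ (p m t).im < 2 * δ * n + δ) := by
    rintro t ht (j | j)
    · obtain ⟨n, hn⟩ := hzs j
      have him : (p (Sum.inl j) t).im = (z j t).im + δ / 2 := by simp [hp, solitonPole]
      obtain ⟨h1, h2⟩ := hn t ht
      exact ⟨n, Or.inl ⟨rfl, by rw [him]; linarith, by rw [him]; linarith⟩⟩
    · obtain ⟨n, hn⟩ := hws j
      have him : (p (Sum.inr j) t).im = (w j t).im - δ / 2 := by simp [hp, solitonPole]
      obtain ⟨h1, h2⟩ := hn t ht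
      exact ⟨n, Or.inr ⟨rfl, by rw [him]; linarith, by rw [him]; linarith⟩⟩
  have hpz : ∀ j, p (Sum.inl j) = fun t => z j t + Complex.I * δ / 2 := fun j => rfl
  have hpw : ∀ j, p (Sum.inr j) = fun t => w j t - Complex.I * δ / 2 := fun j => rfl
  have hpd : ∀ m, ContDiffOn ℝ 2 (p m) I := by
    rintro (j | j)
    · exact (hz.contDiffOn hI j).add contDiffOn_const
    · exact (hw.contDiffOn hI j).sub contDiffOn_const
  have hdz : ∀ j, deriv (p (Sum.inl j)) = deriv (z j) := fun j => by
    ext t; rw [hpz, deriv_add_const]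
  have hdw : ∀ j, deriv (p (Sum.inr j)) = deriv (w j) := fun j => by
    ext t; rw [hpw, deriv_sub_const]
  have hdiff : ∀ t ∈ I, ∀ m, DifferentiableAt ℝ (p m) t := by
    rintro t ht (j | j)
    · exact (hz.differentiableAt t ht j).add_const _
    · exact (hw.differentiableAt t ht j).sub_const _
  -- The factor 1 + r_j r_m is 2 for like charges, which gives the coefficient -4, and 0 for
  -- opposite ones, so the two Calogero–Moser systems combine without coupling.
  have hcm : ∀ t ∈ I, ∀ j, HasDerivAt (deriv (p j))
      (-2 * ∑ m ∈ Finset.univ.erase j, (1 + charge N j * charge N m)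
        * (periods L δ hL hδ).derivWeierstrassP (p j t - p m t)) t := by
    rintro t ht (j | j)
    · rw [hdz]
      refine (hz.equation t ht j).congr_deriv ?_
      simp only [sum_erase_inl, ezz, charge, Sum.elim_inl, Sum.elim_inr, ← Finset.mul_sum]
      ring
    · rw [hdw]
      refine (hw.equation t ht j).congr_deriv ?_
      simp only [sum_erase_inr, eww, charge, Sum.elim_inl, Sum.elim_inr, ← Finset.mul_sum]
      ring
  have hinit : ∀ j, deriv (p j) 0 = poleVelocity (periods L δ hL hδ) (slope₂ L δ hL hδ)
      (charge N) (fun m => p m 0) j := by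
    rintro (j | j)
    · rw [hdz, hz1, poleVelocity]
      simp only [sum_erase_inl, ezz, ezw, charge, Sum.elim_inl, Sum.elim_inr, ← Finset.mul_sum,
        zeta₂_eq, hz0, hw0]
      ring
    -- The initial velocity is given with +iδ, whereas the poles differ by b_j - a_k - iδ; the
    -- period 2iδ of ζ₂ reconciles the two.
    · have hper : ∀ k, zetaLin (periods L δ hL hδ) (slope₂ L δ hL hδ)
          (b j - a k + Complex.I * δ) = zetaLin (periods L δ hL hδ) (slope₂ L δ hL hδ)
          (b j - a k - Complex.I * δ) := fun k => by
        have h := hcross' 0 h0 j k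
        rw [hz0, hw0] at h
        rw [← zeta₂_add_two_I_delta hL hδ h]
        congr 1
        ring
      rw [hdw, hw1, poleVelocity]
      simp only [sum_erase_inr, eww, ewz, charge, Sum.elim_inl, Sum.elim_inr, ← Finset.mul_sum,
        zeta₂_eq, hz0, hw0, hper]
      ring
  refine isPeriodicSolution_of_poles hL hδ (charge N) sum_charge p hI hpd hpp hstrip
    (deriv_eq_poleVelocity _ (charge N) p sum_charge charge_sq hI' hpp hdiff hcm h0 hinit)
    (fun t ht x => ?_) (fun t ht x => ?_)
  · have hz' : ∀ k, (x : ℂ) - z k t - Complex.I * δ / 2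
        = x + 0 - (z k t + Complex.I * δ / 2) := fun k => by ring
    have hw' : ∀ k, (x : ℂ) - w k t + Complex.I * δ / 2
        = x + 0 - (w k t - Complex.I * δ / 2) := fun k => by ring
    simp only [solitonU, poleField, Fintype.sum_sum_type, charge, Sum.elim_inl, Sum.elim_inr,
      hpz, hpw, one_mul, ← Finset.mul_sum, zeta₂_eq, hz', hw']
    ring
  -- The w-terms of v carry the shift -iδ/2, while the pole field at σ = iδ has +3iδ/2; these differ
  -- by the period 2iδ.
  · have hper : ∀ k, zetaLin (periods L δ hL hδ) (slope₂ L δ hL hδ)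
        (x - w k t - Complex.I * δ / 2) = zetaLin (periods L δ hL hδ) (slope₂ L δ hL hδ)
        (x + Complex.I * δ - (w k t - Complex.I * δ / 2)) := fun k => by
      have h : (x : ℂ) - w k t - Complex.I * δ / 2 ∉ (periods L δ hL hδ).lattice := by
        obtain ⟨n, hn⟩ := hws k
        obtain ⟨h1, h2⟩ := hn t ht
        have him : ((x : ℂ) - w k t - Complex.I * δ / 2).im = -(w k t).im - δ / 2 := by simp
        refine notMem_lattice_of_im hL hδ (-n - 1) ?_ ?_ <;> rw [him] <;> push_cast <;> linarith
      rw [← zeta₂_add_two_I_delta hL hδ h]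
      congr 1
      ring
    have hz' : ∀ k, (x : ℂ) - z k t + Complex.I * δ / 2
        = x + Complex.I * δ - (z k t + Complex.I * δ / 2) := fun k => by ring
    simp only [solitonV, poleField, Fintype.sum_sum_type, charge, Sum.elim_inl, Sum.elim_inr,
      hpz, hpw, one_mul, ← Finset.mul_sum, zeta₂_eq, hper, hz']
    ring
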